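/- **Model.** Fix $\kappa\in(0,1/2)$, $q\in(0,1)$, $\beta\in[0,1)$ and $\mu_1,\mu_2,\gamma_1,\gamma_2\in\mathbb R$. For each $n$, nodes $1,\dots,n$ receive independent labels $c_i\in\{1,2\}$ with $\mathbb P(c_i=1)=\kappa$. Given $\bm c$, independently over pairs $i<j$: $A_{ij}$ is Bernoulli with success probability $q+\mu_1/\sqrt n$ if $c_i=c_j=1$, $q+\mu_2/\sqrt n$ if $c_i=c_j=2$, and $q$ if $c_i\ne c_j$; and, given $A_{ij}$, the observations $Y_{ij}$ and $Y^*_{ij}$ are independent and identically distributed with $\mathbb P(Y_{ij}=0\mid A_{ij}=1)=\beta-\gamma_1/\sqrt n$, $\beta-\gamma_2/\sqrt n$, $\beta$ in the three cases respectively, and $\mathbb P(Y_{ij}=0\mid A_{ij}=0)=1$. (Probabilities are truncated to $[0,1]$, which for $\kappa,q,\beta\in(0,1)$ matters only for finitely many $n$.) Only $(\bm c,Y,Y^*)$ is observed. **Estimators.** Let $n_g=\#\{i:c_i=g\}$, $N_g=\binom{n_g}{2}$ for $g=1,2$, and $N_{\mathrm b}=n_1n_2$. For $\mathrm x\in\{1,2,\mathrm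 b\}$ let $\hat u_{1,\mathrm x}=N_{\mathrm x}^{-1}\sum Y_{ij}$, $\hat u_{2,\mathrm x}=(2N_{\mathrm x})^{-1}\sum|Y_{ij}-Y^*_{ij}|$, summed over the pairs $i<j$ within group 1, within group 2, or between the groups, respectively. Put $\hat\beta_{\mathrm x}=\hat u_{2,\mathrm x}/\hat u_{1,\mathrm x}$, and for $g=1,2$ $$\hat\gamma_g=\sqrt n(\hat\beta_{\mathrm b}-\hat\beta_g),\qquad \hat\mu_g=\sqrt n\Big(\tfrac{\hat u_{1,g}}{1-\hat\beta_g}-\tfrac{\hat u_{1,\mathrm b}}{1-\hat\beta_{\mathrm b}}\Big).$$ **Precision matrices.** Let $\Sigma_u(x,y)=\begin{pmatrix}x(1-x)&(1/2-x)y\\(1/2-x)y&(1/2-y)y\end{pmatrix}$, and let $\bm Dh$, $\bm Dg$ be the Jacobian matrices of $$h(u,v,w,x,y,z)=\Big(\tfrac zy,\ \tfrac zy-\tfrac vu,\ \tfrac zy-\tfrac xw\Big),$$ $$g(u,v,w,x,y,z)=\Big(\tfrac zy-\tfrac vu,\ \tfrac zy-\tfrac xw,\ \tfrac{u^2}{u-v}-\tfrac{y^2}{y-z},\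 \tfrac{w^2}{w-x}-\tfrac{y^2}{y-z}\Big).$$ With $q^*=(1-\beta)q$, $\xi^*=(q^*,\beta q^*,q^*,\beta q^*,q^*,\beta q^*)$ and $\Sigma_u=\Sigma_u(q^*,\beta q^*)$ let $$S=\mathrm{diag}\Big(\tfrac{2}{\kappa^2}\Sigma_u,\tfrac{2}{(1-\kappa)^2}\Sigma_u,\tfrac1{\kappa(1-\kappa)}\Sigma_u\Big),\quad \Sigma_\beta=\bm Dh(\xi^*)\,S\,\bm Dh(\xi^*)^{\intercal},\quad \Sigma_\mu=\bm Dg(\xi^*)\,S\,\bm Dg(\xi^*)^{\intercal}.$$ The plug-in estimators are $\widehat\Theta_\beta=\{\bm Dh(\hat\xi)\hat S\bm Dh(\hat\xi)^{\intercal}\}^{-1}$ and $\widehat\Theta_\mu=\{\bm Dg(\hat\xi)\hat S\bm Dg(\hat\xi)^{\intercal}\}^{-1}$, where $\hat\xi=(\hat u_{1,1},\hat u_{2,1},\hat u_{1,2},\hat u_{2,2},\hat u_{1,\mathrm b},\hat u_{2,\mathrm b})$ and $\hat S$ is block diagonal with blocks $\frac{n^2}{N_{\mathrm x}}\Sigma_u(\hat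 u_{1,\mathrm x},\hat u_{2,\mathrm x})$, $\mathrm x=1,2,\mathrm b$. **Test.** Fix $\bar\beta\in(0,1)$ and $\alpha\in(0,1)$, and let $c^{(\nu)}_\alpha$ be the $1-\alpha$ quantile of $\chi^2_\nu$. Let $$Q_{n,\bar\beta}(b)=V_b^{\intercal}\,\widehat\Theta_\beta\,V_b,\quad V_b=(n(\hat\beta_{\mathrm b}-b),\sqrt n\hat\gamma_1,\sqrt n\hat\gamma_2)^{\intercal},$$ $$Q_{n,\mu}=n\,W^{\intercal}\,\widehat\Theta_\mu\,W,\quad W=(\hat\gamma_1,\hat\gamma_2,\hat\mu_1,\hat\mu_2)^{\intercal},$$ $$\Psi_\alpha=\mathbb I(Y\ne Y^*)\cdot\mathbb I\Big\{\min_{b\in[0,\bar\beta]}Q_{n,\bar\beta}(b)>c^{(3)}_\alpha\Big\}\cdot\mathbb I\big(Q_{n,\mu}>c^{(4)}_\alpha\big).$$ **Theorem.** (i) For every parameter in the null hypothesis $$H_{0,\bar\beta}=\{\gamma_1=\gamma_2=0,\ \beta\in[0,\bar\beta]\}\ \cup\ \{\gamma_1=\gamma_2=\mu_1=\mu_2=0\},$$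 the test controls the type I error asymptotically at level $\alpha$: $\limsup_{n\to\infty}\mathbb P(\Psi_\alpha=1)\le\alpha$. (ii) For every parameter with $\beta\in(0,1)$, null or not, $\Sigma_\beta$ and $\Sigma_\mu$ are invertible, and $\widehat\Theta_\beta\to\Sigma_\beta^{-1}$ and $\widehat\Theta_\mu\to\Sigma_\mu^{-1}$ in probability. (iii) The bound in (i) remains true, at any given parameter in $H_{0,\bar\beta}$, if $\widehat\Theta_\beta,\widehat\Theta_\mu$ are replaced in $\Psi_\alpha$ by any other matrix-valued functions of $(\bm c,Y,Y^*)$ which, if $\beta>0$ at that parameter, converge in probability under it to $\Sigma_\beta^{-1}$ and $\Sigma_\mu^{-1}$. -/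

import Mathlib

open MeasureTheory ProbabilityTheory Filter Topology

namespace NoisySBM

noncomputable section

/-! ### The model -/

/-- Parameters of the 2-group stochastic block model with type II observation errors:
`κ` is the minority proportion, `q` the between-group edge probability of the true network,
`μ₁, μ₂` the local perturbations of the within-group edge probabilities, `β` the between-group
type II error rate, `γ₁, γ₂` the local perturbations of the within-group error rates. -/
structure Params where
  κ : ℝ
  q : ℝ
  μ₁ : ℝ
  μ₂ : ℝ
  β : ℝ
  γ₁ : ℝ
  γ₂ : ℝ

/-- The three kinds of node pairs: within the minority group, within the majority group,
between the groups. -/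
inductive Block where
  | one
  | two
  | between
  deriving DecidableEq

/-- Group labels of the nodes; `true` is the minority group (group 1), `false` the majority
group (group 2). -/
abbrev Labels (n : ℕ) : Type := Fin n → Bool

/-- Node pairs `i < j`. -/
abbrev Pair (n : ℕ) : Type := {e : Fin n × Fin n // e.1 < e.2}

/-- An undirected network without self-loops, i.e. a symmetric binary adjacency matrix with zero
diagonal, given by its entries above the diagonal. -/
abbrev Network (n : ℕ) : Type := Pair n → Bool

/-- The block of a node pair. -/
def block {n : ℕ} (c : Labels n) (e : Pair n) : Block :=
  match c e.1.1, c e.1.2 with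
  | true, true => .one
  | false, false => .two
  | _, _ => .between

/-- Edge probabilities of the true network. -/
def edgeProb (θ : Params) (n : ℕ) : Block → ℝ
  | .one => θ.q + θ.μ₁ / √n
  | .two => θ.q + θ.μ₂ / √n
  | .between => θ.q

/-- Type II error rates `P(Y_ij = 0 | A_ij = 1)`. -/
def errProb (θ : Params) (n : ℕ) : Block → ℝ
  | .one => θ.β - θ.γ₁ / √n
  | .two => θ.β - θ.γ₂ / √n
  | .between => θ.β

/-- Truncation to `[0, 1]`. For `κ, q, β ∈ (0,1)` it changes none of the model probabilities once
`n` is large; it only makes the model defined for the finitely many remaining `n`. -/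
def toUnit (x : ℝ) : unitInterval := Set.projIcc (0 : ℝ) 1 zero_le_one x

/-- Conditional law of an observed entry given the true entry `a`: a true edge is missed with
probability `b`, a non-edge is never reported as an edge. -/
def obsLaw (b : ℝ) (a : Bool) : Measure Bool :=
  if a then bernoulliMeasure false true (toUnit b) else Measure.dirac false

instance isProbabilityMeasure_obsLaw (b : ℝ) (a : Bool) : IsProbabilityMeasure (obsLaw b a) := by
  unfold obsLaw
  split_ifs <;> infer_instance

/-- Joint law of `(A_ij, Y_ij, Y*_ij)`: `A_ij` is Bernoulli with parameter `p`, and `Y_ij, Y*_ij`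
are conditionally independent and identically distributed given `A_ij`. -/
def edgeLaw (p b : ℝ) : Measure (Bool × Bool × Bool) :=
  (bernoulliMeasure true false (toUnit p)) ⊗ₘ
    (Kernel.ofFunOfCountable fun a => (obsLaw b a).prod (obsLaw b a))

instance isProbabilityMeasure_edgeLaw (p b : ℝ) : IsProbabilityMeasure (edgeLaw p b) := by
  have : IsMarkovKernel (Kernel.ofFunOfCountable fun a : Bool => (obsLaw b a).prod (obsLaw b a)) :=
    ⟨fun a => inferInstanceAs (IsProbabilityMeasure ((obsLaw b a).prod (obsLaw b a)))⟩
  unfold edgeLaw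
  infer_instance

/-- Joint law of the labels and of `(A, Y, Y*)` on `n` nodes: labels are independent and equal to
group 1 with probability `κ`; given the labels, the triples `(A_ij, Y_ij, Y*_ij)`, `i < j`, are
independent, with probabilities determined by the block of the pair. -/
def law (θ : Params) (n : ℕ) : Measure (Labels n × (Pair n → Bool × Bool × Bool)) :=
  (Measure.pi fun _ : Fin n => bernoulliMeasure true false (toUnit θ.κ)) ⊗ₘ
    (Kernel.ofFunOfCountable fun c : Labels n =>
      Measure.pi fun e : Pair n => edgeLaw (edgeProb θ n (block c e)) (errProb θ n (block c e)))

instance isProbabilityMeasure_law (θ : Params) (n : ℕ) : IsProbabilityMeasure (law θ n) := by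
  have : IsMarkovKernel (Kernel.ofFunOfCountable fun c : Labels n => Measure.pi fun e : Pair n =>
      edgeLaw (edgeProb θ n (block c e)) (errProb θ n (block c e))) :=
    ⟨fun c => inferInstanceAs (IsProbabilityMeasure (Measure.pi fun e : Pair n =>
      edgeLaw (edgeProb θ n (block c e)) (errProb θ n (block c e))))⟩
  unfold law
  infer_instance

/-- The observed data `(c, Y, Y*)`. -/
structure Data (n : ℕ) where
  c : Labels n
  Y : Network n
  Ystar : Network n

/-- The observed part of a sample; the true network `A` is dropped. -/
def observe {n : ℕ} (ω : Labels n × (Pair n → Bool × Bool × Bool)) : Data n :=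
  ⟨ω.1, fun e => (ω.2 e).2.1, fun e => (ω.2 e).2.2⟩

/-! ### Moment estimators -/

/-- A binary entry as a real number. -/
def entry (b : Bool) : ℝ := if b then 1 else 0

/-- Size `n₁` of the minority group. -/
def size₁ {n : ℕ} (c : Labels n) : ℕ := (Finset.univ.filter fun i => c i = true).card

/-- Size `n₂` of the majority group. -/
def size₂ {n : ℕ} (c : Labels n) : ℕ := (Finset.univ.filter fun i => c i = false).card

/-- The numbers of node pairs `N₁`, `N₂`, `N_b`. -/
def numPairs {n : ℕ} (c : Labels n) : Block → ℝ
  | .one => ((size₁ c).choose 2 : ℕ)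
  | .two => ((size₂ c).choose 2 : ℕ)
  | .between => (size₁ c * size₂ c : ℕ)

/-- First moments `û_{1,x}`. -/
def u₁ {n : ℕ} (d : Data n) (k : Block) : ℝ :=
  1 / numPairs d.c k * ∑ e : Pair n with block d.c e = k, entry (d.Y e)

/-- Second moments `û_{2,x}`. -/
def u₂ {n : ℕ} (d : Data n) (k : Block) : ℝ :=
  1 / (2 * numPairs d.c k) *
    ∑ e : Pair n with block d.c e = k, |entry (d.Y e) - entry (d.Ystar e)|

/-- Error rate estimators `β̂_x`. -/
def betaHat {n : ℕ} (d : Data n) (k : Block) : ℝ := u₂ d k / u₁ d k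

/-- `γ̂_g = √n (β̂_b - β̂_g)`. -/
def gammaHat {n : ℕ} (d : Data n) (g : Block) : ℝ :=
  √n * (betaHat d .between - betaHat d g)

/-- `μ̂_g = √n (û_{1,g} / (1 - β̂_g) - û_{1,b} / (1 - β̂_b))`. -/
def muHat {n : ℕ} (d : Data n) (g : Block) : ℝ :=
  √n * (u₁ d g / (1 - betaHat d g) - u₁ d .between / (1 - betaHat d .between))

/-! ### Asymptotic covariance matrices and their plug-in estimators -/

/-- Covariance matrix of `(Y_ij, |Y_ij - Y*_ij| / 2)` when their means are `x` and `y`. -/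
def SigmaU (x y : ℝ) : Matrix (Fin 2) (Fin 2) ℝ :=
  !![x * (1 - x), (1 / 2 - x) * y;
     (1 / 2 - x) * y, (1 / 2 - y) * y]

/-- The block diagonal `6 × 6` matrix with `2 × 2` diagonal blocks `S`, `T`, `U`. -/
def blockDiag (S T U : Matrix (Fin 2) (Fin 2) ℝ) : Matrix (Fin 6) (Fin 6) ℝ :=
  !![S 0 0, S 0 1, 0, 0, 0, 0;
     S 1 0, S 1 1, 0, 0, 0, 0;
     0, 0, T 0 0, T 0 1, 0, 0;
     0, 0, T 1 0, T 1 1, 0, 0;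
     0, 0, 0, 0, U 0 0, U 0 1;
     0, 0, 0, 0, U 1 0, U 1 1]

/-- Jacobian matrix of `(u, v, w, x, y, z) ↦ (z/y, z/y - v/u, z/y - x/w)`, the map that takes the
moments `(û_{1,1}, û_{2,1}, û_{1,2}, û_{2,2}, û_{1,b}, û_{2,b})` to
`(β̂_b, γ̂₁/√n, γ̂₂/√n)`. -/
def Dh (u v w x y z : ℝ) : Matrix (Fin 3) (Fin 6) ℝ :=
  !![0, 0, 0, 0, -z / y ^ 2, 1 / y;
     v / u ^ 2, -1 / u, 0, 0, -z / y ^ 2, 1 / y;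
     0, 0, x / w ^ 2, -1 / w, -z / y ^ 2, 1 / y]

/-- Jacobian matrix of
`(u, v, w, x, y, z) ↦ (z/y - v/u, z/y - x/w, u²/(u-v) - y²/(y-z), w²/(w-x) - y²/(y-z))`,
the map that takes the moments to `(γ̂₁, γ̂₂, μ̂₁, μ̂₂)/√n`. -/
def Dg (u v w x y z : ℝ) : Matrix (Fin 4) (Fin 6) ℝ :=
  !![v / u ^ 2, -1 / u, 0, 0, -z / y ^ 2, 1 / y;
     0, 0, x / w ^ 2, -1 / w, -z / y ^ 2, 1 / y;
     u * (u - 2 * v) / (u - v) ^ 2, u ^ 2 / (u - v) ^ 2, 0, 0,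
       -(y * (y - 2 * z)) / (y - z) ^ 2, -y ^ 2 / (y - z) ^ 2;
     0, 0, w * (w - 2 * x) / (w - x) ^ 2, w ^ 2 / (w - x) ^ 2,
       -(y * (y - 2 * z)) / (y - z) ^ 2, -y ^ 2 / (y - z) ^ 2]

/-- Limit of the edge density of the observed networks. -/
def qStar (θ : Params) : ℝ := (1 - θ.β) * θ.q

/-- Asymptotic covariance of `n` times the centred moments. -/
def momentCov (θ : Params) : Matrix (Fin 6) (Fin 6) ℝ :=
  blockDiag ((θ.κ ^ 2 / 2)⁻¹ • SigmaU (qStar θ) (θ.β * qStar θ))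
    (((1 - θ.κ) ^ 2 / 2)⁻¹ • SigmaU (qStar θ) (θ.β * qStar θ))
    ((θ.κ * (1 - θ.κ))⁻¹ • SigmaU (qStar θ) (θ.β * qStar θ))

/-- Asymptotic covariance `Σ_β` of `(n(β̂_b - β), √n(γ̂₁ - γ₁), √n(γ̂₂ - γ₂))`. -/
def SigmaBeta (θ : Params) : Matrix (Fin 3) (Fin 3) ℝ :=
  let D := Dh (qStar θ) (θ.β * qStar θ) (qStar θ) (θ.β * qStar θ) (qStar θ) (θ.β * qStar θ)
  D * momentCov θ * D.transpose

/-- Asymptotic covariance `Σ_μ` of `√n(γ̂₁ - γ₁, γ̂₂ - γ₂, μ̂₁ - μ₁, μ̂₂ - μ₂)`. -/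
def SigmaMu (θ : Params) : Matrix (Fin 4) (Fin 4) ℝ :=
  let D := Dg (qStar θ) (θ.β * qStar θ) (qStar θ) (θ.β * qStar θ) (qStar θ) (θ.β * qStar θ)
  D * momentCov θ * D.transpose

/-- Plug-in estimator of the covariance of `n` times the centred moments. -/
def momentCovHat {n : ℕ} (d : Data n) : Matrix (Fin 6) (Fin 6) ℝ :=
  blockDiag (((n : ℝ) ^ 2 / numPairs d.c .one) • SigmaU (u₁ d .one) (u₂ d .one))
    (((n : ℝ) ^ 2 / numPairs d.c .two) • SigmaU (u₁ d .two) (u₂ d .two))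
    (((n : ℝ) ^ 2 / numPairs d.c .between) • SigmaU (u₁ d .between) (u₂ d .between))

/-- Matrix-valued statistics of the data, for every network size. -/
abbrev MatrixStat (m : ℕ) : Type := ∀ n : ℕ, Data n → Matrix (Fin m) (Fin m) ℝ

/-- The plug-in estimator `Θ̂_β` of the precision matrix `Σ_β⁻¹`. -/
def ThetaBeta : MatrixStat 3 := fun _ d =>
  let D := Dh (u₁ d .one) (u₂ d .one) (u₁ d .two) (u₂ d .two) (u₁ d .between) (u₂ d .between)
  (D * momentCovHat d * D.transpose)⁻¹

/-- The plug-in estimator `Θ̂_μ` of the precision matrix `Σ_μ⁻¹`. -/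
def ThetaMu : MatrixStat 4 := fun _ d =>
  let D := Dg (u₁ d .one) (u₂ d .one) (u₁ d .two) (u₂ d .two) (u₁ d .between) (u₂ d .between)
  (D * momentCovHat d * D.transpose)⁻¹

/-- Convergence in probability, under the parameter `θ`, of a sequence of matrix-valued statistics
to the matrix `M`. -/
def ConsistentAt {m : ℕ} (θ : Params) (T : MatrixStat m) (M : Matrix (Fin m) (Fin m) ℝ) : Prop :=
  ∀ ε : ℝ, 0 < ε →
    Tendsto (fun n : ℕ => law θ n {ω | ∃ i j, ε ≤ |T n (observe ω) i j - M i j|}) atTop (𝓝 0)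

/-! ### The test -/

/-- The quadratic form `vᵀ M v`. -/
def quadForm {m : ℕ} (M : Matrix (Fin m) (Fin m) ℝ) (v : Fin m → ℝ) : ℝ :=
  v ⬝ᵥ M.mulVec v

/-- The statistic `Q_{n,β̄}(b)`. -/
def QBeta (T : MatrixStat 3) {n : ℕ} (d : Data n) (b : ℝ) : ℝ :=
  quadForm (T n d)
    ![n * (betaHat d .between - b), √n * gammaHat d .one, √n * gammaHat d .two]

/-- The statistic `Q_{n,μ}`. -/
def QMu (T : MatrixStat 4) {n : ℕ} (d : Data n) : ℝ :=
  n * quadForm (T n d) ![gammaHat d .one, gammaHat d .two, muHat d .one, muHat d .two]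

/-- The `χ²` distribution with `ν` degrees of freedom: the law of the sum of squares of `ν`
independent standard normal variables. -/
def chiSquared (ν : ℕ) : Measure ℝ :=
  (Measure.pi fun _ : Fin ν => gaussianReal 0 1).map fun z => ∑ i, z i ^ 2

/-- The `1 - α` quantile of the `χ²` distribution with `ν` degrees of freedom. -/
def chiQuantile (ν : ℕ) (α : ℝ) : ℝ := sInf {x : ℝ | 1 - α ≤ cdf (chiSquared ν) x}

open Classical in
/-- The test function `Ψ_α`, built from the weight matrices `Tβ` and `Tμ`. The infimum is that of a
continuous function on a compact interval, hence a minimum. -/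
def testFn (Tβ : MatrixStat 3) (Tμ : MatrixStat 4) (βbar α : ℝ) {n : ℕ} (d : Data n) : ℝ :=
  (if d.Y ≠ d.Ystar then 1 else 0) *
    (if sInf (QBeta Tβ d '' Set.Icc 0 βbar) > chiQuantile 3 α then 1 else 0) *
    (if QMu Tμ d > chiQuantile 4 α then 1 else 0)

/-- Rejection probability of the test on `n` nodes under the parameter `θ`. -/
def rejectProb (Tβ : MatrixStat 3) (Tμ : MatrixStat 4) (βbar α : ℝ) (θ : Params) (n : ℕ) :
    ENNReal :=
  law θ n {ω | testFn Tβ Tμ βbar α (observe ω) = 1}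

/-- The parameter space; `β = 0` is kept because it belongs to the null hypothesis. -/
def InModel (θ : Params) : Prop :=
  0 < θ.κ ∧ θ.κ < 1 / 2 ∧ 0 < θ.q ∧ θ.q < 1 ∧ 0 ≤ θ.β ∧ θ.β < 1

/-- The null hypothesis: balanced and small errors, or balanced errors and a proportionally
representative true network. -/
def InNull (βbar : ℝ) (θ : Params) : Prop :=
  (θ.γ₁ = 0 ∧ θ.γ₂ = 0 ∧ 0 ≤ θ.β ∧ θ.β ≤ βbar) ∨
    (θ.γ₁ = 0 ∧ θ.γ₂ = 0 ∧ θ.μ₁ = 0 ∧ θ.μ₂ = 0)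

end

end NoisySBM

/-!
The rejection event forces both quadratic statistics beyond their quantiles, so at a null parameter
it suffices that one of them is asymptotically chi-squared: `QBeta` at the true `β` (an upper bound
for the infimum over `[0, βbar]`) if `β ≤ βbar`, and `QMu` if `μ₁ = μ₂ = 0`. If `β = 0` there are no
errors, so `Y = Y*` and the test never rejects; from now on `β > 0`.

*Central limit theorem.* Given the labels, any linear combination of the centred moment estimators,
scaled by `n` (`fluct`), is a sum of independent centred terms of order `1 / n`, one for each pair.
A quantitative Lindeberg bound (`norm_integral_exp_sum_sub_exp_le`) compares its characteristic
function with a Gaussian one, and along label sequences with `n₁ / n → κ` the conditional variances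
converge to the quadratic form of `momentCov` (`tendsto_charFun_fluct`). The labels with `n₁` within
`n ^ (3/4)` of its mean have probability tending to one, so `limsup_law_le` transfers bounds on
conditional probabilities to the unconditional law. Lévy's theorem and the portmanteau theorem give
the tail bound `limsup_law_quadForm_le` for the standardised quadratic form, and Chebyshev's
inequality shows that `fluct` is bounded in probability, whence the moment estimators are consistent.

*Consistency.* `momentCov` is positive definite and the Jacobians have full row rank, so
`SigmaBeta` and `SigmaMu` are positive definite. The plug-in matrices are inverses of continuous
functions of the moment estimators and of the `n² / N_x`, so the continuous mapping theorem applies.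

*No delta method is needed.* Under balanced errors the statistics are linear in `fluct` exactly,
with a coefficient matrix depending on the moment estimators: with means `m` and `β m` of `û₁, û₂`,
`β̂ - β = ((û₂ - β m) - β (û₁ - m)) / û₁`, and with `s = (1 - β) q`,
`û₁² / (û₁ - û₂) - q = ((û₁ + s - q) (û₁ - s) + q (û₂ - β s)) / (û₁ - û₂)`. The coefficient matrices
converge in probability to the Jacobians, so that replacing coefficients and weights by their limits
changes the statistic by a quadratic form in `fluct` with vanishing coefficients
(`limsup_law_quadForm_gt_le`).
-/

namespace NoisySBM

noncomputable section

/-! ### Characteristic functions of sums of small independent variables -/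

theorem norm_prod_sub_prod_le {ι : Type*} (s : Finset ι) (a b : ι → ℂ)
    (ha : ∀ i ∈ s, ‖a i‖ ≤ 1) (hb : ∀ i ∈ s, ‖b i‖ ≤ 1) :
    ‖∏ i ∈ s, a i - ∏ i ∈ s, b i‖ ≤ ∑ i ∈ s, ‖a i - b i‖ := by
  classical
  induction s using Finset.induction_on with
  | empty => simp
  | insert i s hi ih =>
    rw [Finset.prod_insert hi, Finset.prod_insert hi, Finset.sum_insert hi]
    have h := ih (fun j hj => ha j (Finset.mem_insert_of_mem hj))
      (fun j hj => hb j (Finset.mem_insert_of_mem hj))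
    have hp : ‖∏ j ∈ s, a j‖ ≤ 1 := by
      rw [norm_prod]
      exact Finset.prod_le_one (fun _ _ => norm_nonneg _)
        fun j hj => ha j (Finset.mem_insert_of_mem hj)
    have hbi := hb i (Finset.mem_insert_self i s)
    calc ‖a i * ∏ j ∈ s, a j - b i * ∏ j ∈ s, b j‖
        = ‖(a i - b i) * ∏ j ∈ s, a j + b i * (∏ j ∈ s, a j - ∏ j ∈ s, b j)‖ := by
          congr 1; ring
      _ ≤ ‖a i - b i‖ * ‖∏ j ∈ s, a j‖ + ‖b i‖ * ‖∏ j ∈ s, a j - ∏ j ∈ s, b j‖ := by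
          refine (norm_add_le _ _).trans ?_
          rw [norm_mul, norm_mul]
      _ ≤ ‖a i - b i‖ * 1 + 1 * ∑ j ∈ s, ‖a j - b j‖ := by gcongr
      _ = _ := by ring

/-- Second order Taylor expansion of the characteristic function of a small centred variable,
compared with that of a Gaussian of the same variance. -/
theorem norm_integral_exp_sub_exp_le {Ω : Type*} [MeasurableSpace Ω] {μ : Measure Ω}
    [IsProbabilityMeasure μ] {η : Ω → ℝ} (hm : Measurable η) {δ : ℝ} (hδ : δ ≤ 1)
    (hη : ∀ ω, |η ω| ≤ δ) (h0 : ∫ ω, η ω ∂μ = 0) :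
    ‖∫ ω, Complex.exp (Complex.I * η ω) ∂μ - Complex.exp (-((∫ ω, η ω ^ 2 ∂μ : ℝ) : ℂ) / 2)‖ ≤
      2 * δ * ∫ ω, η ω ^ 2 ∂μ := by
  have hδ0 : 0 ≤ δ := by
    obtain ⟨ω₀⟩ := nonempty_of_isProbabilityMeasure μ
    exact (abs_nonneg _).trans (hη ω₀)
  have hi1 : Integrable η μ :=
    Integrable.of_bound hm.aestronglyMeasurable δ (by simpa using .of_forall hη)
  have hi2 : Integrable (fun ω => η ω ^ 2) μ :=
    Integrable.of_bound (hm.pow_const 2).aestronglyMeasurable (δ ^ 2)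
      (.of_forall fun ω => by
        rw [Real.norm_eq_abs, abs_pow]; gcongr; exact hη ω)
  set v : ℝ := ∫ ω, η ω ^ 2 ∂μ with hv
  have hv0 : 0 ≤ v := integral_nonneg fun ω => sq_nonneg _
  have hvδ : v ≤ δ ^ 2 := by
    calc v ≤ ∫ _, δ ^ 2 ∂μ := by
          refine integral_mono hi2 (integrable_const _) fun ω => ?_
          rw [← sq_abs]; gcongr; exact hη ω
      _ = δ ^ 2 := by simp
  have hmc : Measurable fun ω => (η ω : ℂ) := Complex.measurable_ofReal.comp hm
  have hie : Integrable (fun ω => Complex.exp (Complex.I * η ω)) μ :=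
    Integrable.of_bound (by fun_prop) 1
      (.of_forall fun ω => by rw [Complex.norm_exp_I_mul_ofReal])
  have hi1c : Integrable (fun ω => (η ω : ℂ)) μ := hi1.ofReal
  have hi2c : Integrable (fun ω => ((η ω ^ 2 : ℝ) : ℂ)) μ := hi2.ofReal
  have hT : Integrable
      (fun ω => (1 : ℂ) + Complex.I * η ω - (1 / 2 : ℂ) * ((η ω ^ 2 : ℝ) : ℂ)) μ :=
    ((integrable_const _).add (hi1c.const_mul _)).sub (hi2c.const_mul _)
  have hTint : ∫ ω, ((1 : ℂ) + Complex.I * η ω - (1 / 2 : ℂ) * ((η ω ^ 2 : ℝ) : ℂ)) ∂μ =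
      1 - (v : ℂ) / 2 := by
    have hc : Integrable (fun _ : Ω => (1 : ℂ)) μ := integrable_const _
    have hlin : Integrable (fun ω => Complex.I * (η ω : ℂ)) μ := hi1c.const_mul _
    rw [integral_sub (f := fun ω => (1 : ℂ) + Complex.I * η ω) (hc.add hlin) (hi2c.const_mul _),
      integral_add hc hlin, integral_const_mul, integral_const_mul,
      integral_complex_ofReal, integral_complex_ofReal, h0, ← hv]
    simp
    ring
  have h1 : ‖∫ ω, Complex.exp (Complex.I * η ω) ∂μ - (1 - (v : ℂ) / 2)‖ ≤ δ * v := by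
    rw [← hTint, ← integral_sub hie hT]
    calc _ ≤ ∫ ω, δ * η ω ^ 2 ∂μ := by
          refine norm_integral_le_of_norm_le (hi2.const_mul _) (.of_forall fun ω => ?_)
          have hb : ‖Complex.I * (η ω : ℂ)‖ = |η ω| := by simp
          have h := Complex.exp_bound (x := Complex.I * η ω) (by rw [hb]; exact (hη ω).trans hδ)
            (n := 3) (by norm_num)
          rw [hb] at h
          have hs : ∑ m ∈ Finset.range 3, (Complex.I * (η ω : ℂ)) ^ m / (m.factorial : ℂ) =
              (1 : ℂ) + Complex.I * η ω - (1 / 2 : ℂ) * ((η ω ^ 2 : ℝ) : ℂ) := by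
            simp [Finset.sum_range_succ, Nat.factorial, mul_pow]
            ring
          rw [hs] at h
          refine h.trans ?_
          have h3 : |η ω| ^ 3 ≤ δ * η ω ^ 2 := by
            rw [← sq_abs, pow_succ']; gcongr; exact hη ω
          have h4 : ((Nat.succ 3 : ℕ) : ℝ) *
              (((Nat.factorial 3 : ℕ) : ℝ) * ((3 : ℕ) : ℝ))⁻¹ ≤ 1 := by
            norm_num [Nat.factorial]
          calc _ ≤ |η ω| ^ 3 * 1 := by gcongr
            _ ≤ _ := by simpa using h3
      _ = δ * v := by rw [integral_const_mul]
  have h2 : ‖(1 - (v : ℂ) / 2) - Complex.exp (-(v : ℂ) / 2)‖ ≤ δ * v := by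
    have hn : ‖(-(v : ℂ) / 2)‖ = v / 2 := by simp [abs_of_nonneg hv0]
    have hv1 : v ≤ 1 := hvδ.trans (pow_le_one₀ hδ0 hδ)
    have h := Complex.norm_exp_sub_one_sub_id_le (x := -(v : ℂ) / 2) (by rw [hn]; linarith)
    rw [hn] at h
    rw [norm_sub_rev]
    calc _ = ‖Complex.exp (-(v : ℂ) / 2) - 1 - -(v : ℂ) / 2‖ := by congr 1; ring
      _ ≤ (v / 2) ^ 2 := h
      _ ≤ δ * v := by nlinarith
  calc _ = ‖(∫ ω, Complex.exp (Complex.I * η ω) ∂μ - (1 - (v : ℂ) / 2)) +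
        ((1 - (v : ℂ) / 2) - Complex.exp (-(v : ℂ) / 2))‖ := by congr 1; ring
    _ ≤ δ * v + δ * v := (norm_add_le _ _).trans (add_le_add h1 h2)
    _ = _ := by ring

/-- Quantitative Lindeberg bound: a sum of independent centred variables that are all at most `δ`
has nearly the characteristic function of a Gaussian of the same variance. -/
theorem norm_integral_exp_sum_sub_exp_le {ι : Type*} [Fintype ι] {Ω : ι → Type*}
    [∀ i, MeasurableSpace (Ω i)] {μ : ∀ i, Measure (Ω i)} [∀ i, IsProbabilityMeasure (μ i)]
    {η : ∀ i, Ω i → ℝ} (hm : ∀ i, Measurable (η i)) {δ : ℝ} (hδ : δ ≤ 1)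
    (hη : ∀ i ω, |η i ω| ≤ δ) (h0 : ∀ i, ∫ ω, η i ω ∂μ i = 0) :
    ‖∫ ω, Complex.exp (Complex.I * ((∑ i, η i (ω i) : ℝ) : ℂ)) ∂Measure.pi μ -
        Complex.exp (-((∑ i, ∫ ω, η i ω ^ 2 ∂μ i : ℝ) : ℂ) / 2)‖ ≤
      2 * δ * ∑ i, ∫ ω, η i ω ^ 2 ∂μ i := by
  have hl : ∫ ω, Complex.exp (Complex.I * ((∑ i, η i (ω i) : ℝ) : ℂ)) ∂Measure.pi μ =
      ∏ i, ∫ ω, Complex.exp (Complex.I * η i ω) ∂μ i := by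
    rw [← integral_fintype_prod_eq_prod (fun i ω => Complex.exp (Complex.I * η i ω))]
    congr 1 with ω
    rw [← Complex.exp_sum, ← Finset.mul_sum]
    push_cast
    rfl
  have hr : Complex.exp (-((∑ i, ∫ ω, η i ω ^ 2 ∂μ i : ℝ) : ℂ) / 2) =
      ∏ i, Complex.exp (-((∫ ω, η i ω ^ 2 ∂μ i : ℝ) : ℂ) / 2) := by
    rw [← Complex.exp_sum, ← Finset.sum_div, Finset.sum_neg_distrib]
    push_cast
    rfl
  rw [hl, hr, Finset.mul_sum]
  refine (norm_prod_sub_prod_le _ _ _ (fun i _ => ?_) fun i _ => ?_).trans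
    (Finset.sum_le_sum fun i _ => norm_integral_exp_sub_exp_le (hm i) hδ (hη i) (h0 i))
  · refine (norm_integral_le_of_norm_le_const (μ := μ i) (C := 1) (.of_forall fun ω => ?_)).trans
      (by simp)
    rw [Complex.norm_exp_I_mul_ofReal]
  · rw [Complex.norm_exp]
    simp only [Complex.neg_re, Complex.div_ofNat_re, Complex.ofReal_re, Real.exp_le_one_iff]
    have : 0 ≤ ∫ ω, η i ω ^ 2 ∂μ i := integral_nonneg fun ω => sq_nonneg _
    linarith

/-! ### Limits superior of probabilities and the chi-squared tail -/

theorem limsup_le_of_le_add {f g h : ℕ → ENNReal} {L : ENNReal}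
    (hf : ∀ᶠ n in atTop, f n ≤ g n + h n) (hg : limsup g atTop ≤ L)
    (hh : Tendsto h atTop (𝓝 0)) : limsup f atTop ≤ L := by
  rcases eq_or_ne L ⊤ with rfl | hL
  · exact le_top
  refine ENNReal.le_of_forall_pos_le_add fun ε hε _ => ?_
  have hε2 : (0 : ENNReal) < ε / 2 := by
    simpa using hε.ne'
  have h1 : ∀ᶠ n in atTop, g n < L + ε / 2 :=
    eventually_lt_of_limsup_lt (hg.trans_lt (ENNReal.lt_add_right hL hε2.ne'))
  have h2 : ∀ᶠ n in atTop, h n < ε / 2 := hh.eventually_lt_const hε2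
  refine limsup_le_of_le (h := ?_)
  filter_upwards [hf, h1, h2] with n a b c
  calc f n ≤ g n + h n := a
    _ ≤ (L + ε / 2) + ε / 2 := add_le_add b.le c.le
    _ = L + ε := by rw [add_assoc, ENNReal.add_halves]

theorem tendsto_zero_of_limsup_le {f : ℕ → ENNReal} (h : limsup f atTop ≤ 0) :
    Tendsto f atTop (𝓝 0) :=
  tendsto_of_le_liminf_of_limsup_le zero_le (h.trans le_rfl)

instance isProbabilityMeasure_chiSquared (ν : ℕ) : IsProbabilityMeasure (chiSquared ν) :=
  Measure.isProbabilityMeasure_map (Measurable.aemeasurable (by fun_prop))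

/-- Given the other coordinates, at most two values of the first one put the sum of squares at
`c`. -/
theorem chiSquared_singleton (ν : ℕ) (c : ℝ) : chiSquared (ν + 1) {c} = 0 := by
  rw [chiSquared, Measure.map_apply (by fun_prop) (measurableSet_singleton c)]
  have hmp := measurePreserving_piFinSuccAbove (fun _ : Fin (ν + 1) => gaussianReal 0 1) 0
  set s : Set (ℝ × (Fin ν → ℝ)) := {z | z.1 ^ 2 + ∑ i, z.2 i ^ 2 = c} with hs
  have hsm : MeasurableSet s := measurableSet_eq_fun (by fun_prop) (by fun_prop)
  have hpre : (fun z : Fin (ν + 1) → ℝ => ∑ i, z i ^ 2) ⁻¹' {c} =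
      MeasurableEquiv.piFinSuccAbove (fun _ => ℝ) 0 ⁻¹' s := by
    ext z
    simp [hs, Fin.sum_univ_succ, MeasurableEquiv.piFinSuccAbove, Fin.insertNthEquiv, Fin.tail]
  rw [hpre, hmp.measure_preimage hsm.nullMeasurableSet, Measure.prod_apply_symm hsm]
  refine lintegral_eq_zero_of_ae_eq_zero (.of_forall fun y => ?_)
  have hfin : ((fun x : ℝ => (x, y)) ⁻¹' s).Finite := by
    refine Set.Finite.subset (Set.toFinite {√(c - ∑ i, y i ^ 2), -√(c - ∑ i, y i ^ 2)}) ?_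
    intro x hx
    have hx' : x ^ 2 = c - ∑ i, y i ^ 2 := by
      simp only [hs, Set.mem_preimage, Set.mem_ofPred_eq] at hx
      linarith
    rw [← hx', Real.sqrt_sq_eq_abs]
    rcases abs_choice x with h | h <;> simp [h]
  have : NullSingletonClass (gaussianReal 0 1) := nullSingletonClass_gaussianReal one_ne_zero
  exact hfin.measure_zero _

/-- The tail beyond the `1 - α` quantile has mass at most `α`: right continuity of the distribution
function handles the open tail, absence of atoms the endpoint. -/
theorem chiSquared_Ici_chiQuantile_le (ν : ℕ) {α : ℝ} (hα0 : 0 < α) (hα1 : α < 1) :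
    chiSquared (ν + 1) (Set.Ici (chiQuantile (ν + 1) α)) ≤ ENNReal.ofReal α := by
  set F := cdf (chiSquared (ν + 1)) with hF
  set A : Set ℝ := {x : ℝ | 1 - α ≤ F x} with hA
  have hne : A.Nonempty := by
    have h := (tendsto_cdf_atTop (chiSquared (ν + 1))).eventually_const_lt
      (show 1 - α < 1 by linarith)
    obtain ⟨x, hx⟩ := h.exists
    exact ⟨x, hx.le⟩
  have hbdd : BddBelow A := by
    have h := (tendsto_cdf_atBot (chiSquared (ν + 1))).eventually_lt_const
      (show 0 < 1 - α by linarith)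
    obtain ⟨b, hb⟩ := h.exists
    refine ⟨b, fun x hx => ?_⟩
    by_contra hlt
    exact absurd (hx.trans (monotone_cdf (chiSquared (ν + 1)) (not_le.1 hlt).le)) (not_le.2 hb)
  have hq : 1 - α ≤ F (sInf A) := by
    have hc : Tendsto F (𝓝[>] sInf A) (𝓝 (F (sInf A))) :=
      ((F.right_continuous (sInf A)).mono Set.Ioi_subset_Ici_self)
    refine ge_of_tendsto hc ?_
    filter_upwards [self_mem_nhdsWithin] with x hx
    obtain ⟨a, ha, hax⟩ := exists_lt_of_csInf_lt hne hx
    exact le_trans ha (monotone_cdf (chiSquared (ν + 1)) hax.le)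
  have hqc : chiQuantile (ν + 1) α = sInf A := rfl
  rw [hqc]
  have hIio : chiSquared (ν + 1) (Set.Ici (sInf A)) = chiSquared (ν + 1) (Set.Ioi (sInf A)) := by
    refine le_antisymm ?_ (measure_mono Set.Ioi_subset_Ici_self)
    rw [← Set.Ioi_union_left]
    exact (measure_union_le _ _).trans (by rw [chiSquared_singleton, add_zero])
  rw [hIio, ← ofReal_measureReal, ← Set.compl_Iic, probReal_compl_eq_one_sub measurableSet_Iic,
    ← cdf_eq_real]
  exact ENNReal.ofReal_le_ofReal (by linarith)

theorem tendsto_measure_Ici_sub (μ : Measure ℝ) [IsFiniteMeasure μ] (c : ℝ) :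
    Tendsto (fun k : ℕ => μ (Set.Ici (c - 1 / ((k : ℝ) + 1)))) atTop (𝓝 (μ (Set.Ici c))) := by
  have h : Set.Ici c = ⋂ k : ℕ, Set.Ici (c - 1 / ((k : ℝ) + 1)) := by
    ext x
    simp only [Set.mem_Ici, Set.mem_iInter]
    constructor
    · intro hx k
      have : 0 < 1 / ((k : ℝ) + 1) := by positivity
      linarith
    · intro hx
      refine le_of_forall_pos_le_add fun ε hε => ?_
      obtain ⟨k, hk⟩ := exists_nat_one_div_lt hε
      linarith [hx k]
  rw [h]
  refine tendsto_measure_iInter_atTop (fun k => measurableSet_Ici.nullMeasurableSet) ?_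
    ⟨0, measure_ne_top _ _⟩
  intro j k hjk
  refine Set.Ici_subset_Ici.2 ?_
  have : (1 : ℝ) / (k + 1) ≤ 1 / (j + 1) := Nat.one_div_le_one_div hjk
  linarith

/-- Lévy's continuity theorem and the portmanteau theorem, for the squared norm of a random vector
which is asymptotically standard normal. -/
theorem limsup_measure_sum_sq_ge_le {Ω : ℕ → Type*} [∀ n, MeasurableSpace (Ω n)]
    (μ : ∀ n, Measure (Ω n)) [∀ n, IsProbabilityMeasure (μ n)] {m : ℕ}
    (W : ∀ n, Ω n → Fin m → ℝ) (hW : ∀ n, Measurable (W n))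
    (h : ∀ s : Fin m → ℝ, Tendsto
      (fun n => ∫ ω, Complex.exp (Complex.I * ((∑ i, s i * W n ω i : ℝ) : ℂ)) ∂μ n) atTop
      (𝓝 (Complex.exp (-((∑ i, s i ^ 2 : ℝ) : ℂ) / 2)))) (c : ℝ) :
    limsup (fun n => μ n {ω | c ≤ ∑ i, W n ω i ^ 2}) atTop ≤ chiSquared m (Set.Ici c) := by
  have hWm : ∀ n, Measurable fun ω => WithLp.toLp 2 (W n ω) := fun n => by
    have := hW n
    fun_prop
  let ρ : ℕ → ProbabilityMeasure (EuclideanSpace ℝ (Fin m)) := fun n =>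
    ⟨(μ n).map fun ω => WithLp.toLp 2 (W n ω),
      Measure.isProbabilityMeasure_map (hWm n).aemeasurable⟩
  let ρ₀ : ProbabilityMeasure (EuclideanSpace ℝ (Fin m)) :=
    ⟨stdGaussian (EuclideanSpace ℝ (Fin m)), inferInstance⟩
  have hconv : Tendsto ρ atTop (𝓝 ρ₀) := by
    rw [ProbabilityMeasure.tendsto_iff_tendsto_charFun]
    intro t
    have h0 : charFun (ρ₀ : Measure (EuclideanSpace ℝ (Fin m))) t =
        Complex.exp (-((∑ i, t i ^ 2 : ℝ) : ℂ) / 2) := by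
      change charFun (stdGaussian (EuclideanSpace ℝ (Fin m))) t = _
      rw [charFun_stdGaussian, ← EuclideanSpace.real_norm_sq_eq]
      push_cast
      rfl
    have h1 : ∀ n, charFun (ρ n : Measure (EuclideanSpace ℝ (Fin m))) t =
        ∫ ω, Complex.exp (Complex.I * ((∑ i, t i * W n ω i : ℝ) : ℂ)) ∂μ n := by
      intro n
      change charFun ((μ n).map fun ω => WithLp.toLp 2 (W n ω)) t = _
      rw [charFun_apply, integral_map (hWm n).aemeasurable (by fun_prop)]
      congr 1 with ω
      rw [mul_comm]
      simp [PiLp.inner_apply]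
    rw [h0]
    simp_rw [h1]
    exact h t
  have hcl : IsClosed {x : EuclideanSpace ℝ (Fin m) | c ≤ ∑ i, x i ^ 2} :=
    isClosed_le (by fun_prop) (by fun_prop)
  have hlim := ProbabilityMeasure.limsup_measure_closed_le_of_tendsto hconv hcl
  have e0 : (ρ₀ : Measure (EuclideanSpace ℝ (Fin m))) {x | c ≤ ∑ i, x i ^ 2} =
      chiSquared m (Set.Ici c) := by
    change stdGaussian (EuclideanSpace ℝ (Fin m)) _ = _
    rw [← map_pi_eq_stdGaussian, Measure.map_apply (by fun_prop) hcl.measurableSet, chiSquared,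
      Measure.map_apply (by fun_prop) measurableSet_Ici]
    rfl
  have e1 : ∀ n, (ρ n : Measure (EuclideanSpace ℝ (Fin m))) {x | c ≤ ∑ i, x i ^ 2} =
      μ n {ω | c ≤ ∑ i, W n ω i ^ 2} := fun n =>
    Measure.map_apply (hWm n) hcl.measurableSet
  rw [e0] at hlim
  simpa only [e1] using hlim

/-! ### The law of the network given the labels -/

/-- The conditional law of the entries `(A_ij, Y_ij, Y*_ij)` given the labels `c`. -/
def pairLaw (θ : Params) (n : ℕ) (c : Labels n) : Measure (Pair n → Bool × Bool × Bool) :=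
  Measure.pi fun e : Pair n => edgeLaw (edgeProb θ n (block c e)) (errProb θ n (block c e))

instance isProbabilityMeasure_pairLaw (θ : Params) (n : ℕ) (c : Labels n) :
    IsProbabilityMeasure (pairLaw θ n c) :=
  inferInstanceAs (IsProbabilityMeasure (Measure.pi _))

/-- The law of the labels. -/
def labelLaw (θ : Params) (n : ℕ) : Measure (Labels n) :=
  Measure.pi fun _ : Fin n => bernoulliMeasure true false (toUnit θ.κ)

instance isProbabilityMeasure_labelLaw (θ : Params) (n : ℕ) :
    IsProbabilityMeasure (labelLaw θ n) :=
  inferInstanceAs (IsProbabilityMeasure (Measure.pi _))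

theorem law_apply (θ : Params) (n : ℕ) (s : Set (Labels n × (Pair n → Bool × Bool × Bool))) :
    law θ n s = ∫⁻ c, pairLaw θ n c (Prod.mk c ⁻¹' s) ∂labelLaw θ n := by
  have : IsMarkovKernel (Kernel.ofFunOfCountable fun c : Labels n => Measure.pi fun e : Pair n =>
      edgeLaw (edgeProb θ n (block c e)) (errProb θ n (block c e))) :=
    ⟨fun c => inferInstanceAs (IsProbabilityMeasure (pairLaw θ n c))⟩
  rw [law, Measure.compProd_apply (MeasurableSet.of_discrete)]
  rfl

theorem coe_toUnit {x : ℝ} (h0 : 0 ≤ x) (h1 : x ≤ 1) : (toUnit x : ℝ) = x := by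
  rw [toUnit, Set.projIcc_of_mem _ ⟨h0, h1⟩]

theorem size₁_eq_sum {n : ℕ} (c : Labels n) : (size₁ c : ℝ) = ∑ i, entry (c i) := by
  simp [size₁, entry]

theorem size₁_add_size₂ {n : ℕ} (c : Labels n) : size₁ c + size₂ c = n := by
  have h := Finset.card_filter_add_card_filter_not (s := (Finset.univ : Finset (Fin n)))
    (fun i => c i = true)
  simpa [size₁, size₂] using h

/-- Chebyshev's inequality for the proportion of group 1. -/
theorem labelLaw_size₁_le {θ : Params} (h0 : 0 ≤ θ.κ) (h1 : θ.κ ≤ 1) (n : ℕ) {r : ℝ} (hr : 0 < r) :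
    labelLaw θ n {c | r ≤ |(size₁ c : ℝ) - n * θ.κ|} ≤ ENNReal.ofReal (n / r ^ 2) := by
  have hmem : ∀ _ : Fin n, MemLp entry 2 (bernoulliMeasure true false (toUnit θ.κ)) := fun _ =>
    MemLp.of_discrete
  have hvar : Var[∑ i, fun c : Labels n => entry (c i); labelLaw θ n] ≤ n := by
    rw [labelLaw, variance_sum_pi (X := fun _ => entry) hmem]
    calc _ ≤ ∑ _ : Fin n, (1 : ℝ) := Finset.sum_le_sum fun i _ => by
          refine (variance_le_expectation_sq (by fun_prop)).trans ?_
          rw [integral_bernoulliMeasure]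
          simp [entry, coe_toUnit h0 h1, h1]
      _ = n := by simp
  have hmean : ∫ c, (∑ i, fun c : Labels n => entry (c i)) c ∂labelLaw θ n = n * θ.κ := by
    simp only [Finset.sum_apply]
    rw [integral_finsetSum _ fun _ _ => Integrable.of_finite]
    have : ∀ i : Fin n, ∫ c : Labels n, entry (c i) ∂labelLaw θ n = θ.κ := by
      intro i
      rw [labelLaw, integral_comp_eval (μ := fun _ : Fin n =>
        bernoulliMeasure true false (toUnit θ.κ)) (f := entry) (by fun_prop),
        integral_bernoulliMeasure]
      simp [entry, coe_toUnit h0 h1]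
    simp [this]
  have h := meas_ge_le_variance_div_sq (μ := labelLaw θ n)
    (X := ∑ i, fun c : Labels n => entry (c i)) MemLp.of_discrete hr
  rw [hmean] at h
  refine le_trans (le_of_eq ?_) (h.trans (ENNReal.ofReal_le_ofReal (by gcongr)))
  congr 1 with c
  simp [size₁_eq_sum]

/-- A bound on conditional probabilities along every label sequence with the right limiting
proportions gives the same bound for the unconditional probabilities: the worst labels within
`n ^ (3/4)` of the mean are such a sequence, and the other labels have vanishing probability. -/
theorem limsup_law_le {θ : Params} (h0 : 0 ≤ θ.κ) (h1 : θ.κ ≤ 1)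
    (s : ∀ n : ℕ, Set (Labels n × (Pair n → Bool × Bool × Bool))) (L : ENNReal)
    (h : ∀ c : ∀ n, Labels n, Tendsto (fun n => (size₁ (c n) : ℝ) / n) atTop (𝓝 θ.κ) →
      limsup (fun n => pairLaw θ n (c n) (Prod.mk (c n) ⁻¹' s n)) atTop ≤ L) :
    limsup (fun n => law θ n (s n)) atTop ≤ L := by
  -- the atypical labels, `n ^ (3/4)` or more away from the mean
  set B : ∀ n : ℕ, Set (Labels n) :=
    fun n => {c | n / √(√n) ≤ |(size₁ c : ℝ) - n * θ.κ|} with hB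
  have hBt : Tendsto (fun n => labelLaw θ n (B n)) atTop (𝓝 0) := by
    have hlim : Tendsto (fun n : ℕ => ENNReal.ofReal (1 / √(n : ℝ))) atTop (𝓝 0) := by
      rw [← ENNReal.ofReal_zero]
      refine ENNReal.tendsto_ofReal ?_
      simp only [one_div]
      exact tendsto_inv_atTop_zero.comp
        (Real.tendsto_sqrt_atTop.comp tendsto_natCast_atTop_atTop)
    refine tendsto_of_tendsto_of_tendsto_of_le_of_le' tendsto_const_nhds hlim
      (.of_forall fun n => zero_le) ?_
    filter_upwards [eventually_gt_atTop 0] with n hn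
    have hn' : (0 : ℝ) < n := by exact_mod_cast hn
    refine (labelLaw_size₁_le h0 h1 n (by positivity)).trans (le_of_eq ?_)
    congr 1
    rw [div_pow, Real.sq_sqrt (Real.sqrt_nonneg _)]
    have hs : √(n : ℝ) * √(n : ℝ) = n := Real.mul_self_sqrt hn'.le
    have hs0 : 0 < √(n : ℝ) := by positivity
    field_simp
    nlinarith
  set f : ∀ n, Labels n → ENNReal := fun n c => pairLaw θ n c (Prod.mk c ⁻¹' s n) with hf
  have hex : ∀ n, ∃ c : Labels n, (B n)ᶜ.Nonempty →
      c ∈ (B n)ᶜ ∧ ∀ c' ∈ (B n)ᶜ, f n c' ≤ f n c := by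
    intro n
    by_cases hne : (B n)ᶜ.Nonempty
    · obtain ⟨c, hc, hmax⟩ := Set.exists_max_image (B n)ᶜ (f n) (Set.toFinite _) hne
      exact ⟨c, fun _ => ⟨hc, hmax⟩⟩
    · exact ⟨fun _ => true, fun h => absurd h hne⟩
  choose c hc using hex
  have hne : ∀ᶠ n in atTop, (B n)ᶜ.Nonempty := by
    filter_upwards [hBt.eventually_lt_const zero_lt_one] with n hn
    by_contra hcon
    rw [Set.not_nonempty_iff_eq_empty, Set.compl_empty_iff] at hcon
    rw [hcon, measure_univ] at hn
    exact lt_irrefl _ hn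
  have hct : Tendsto (fun n => (size₁ (c n) : ℝ) / n) atTop (𝓝 θ.κ) := by
    rw [tendsto_iff_norm_sub_tendsto_zero]
    have hlim : Tendsto (fun n : ℕ => 1 / √(√(n : ℝ))) atTop (𝓝 0) := by
      simp only [one_div]
      exact tendsto_inv_atTop_zero.comp
        (Real.tendsto_sqrt_atTop.comp (Real.tendsto_sqrt_atTop.comp tendsto_natCast_atTop_atTop))
    refine squeeze_zero' (.of_forall fun n => norm_nonneg _) ?_ hlim
    filter_upwards [hne, eventually_gt_atTop 0] with n hn hn0
    have hn' : (0 : ℝ) < n := by exact_mod_cast hn0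
    have hmem := (hc n hn).1
    simp only [hB, Set.mem_compl_iff, Set.mem_ofPred_eq, not_le] at hmem
    rw [Real.norm_eq_abs]
    have : (size₁ (c n) : ℝ) / n - θ.κ = ((size₁ (c n) : ℝ) - n * θ.κ) / n := by field_simp
    rw [this, abs_div, abs_of_pos hn', div_le_iff₀ hn']
    calc _ ≤ n / √(√(n : ℝ)) := hmem.le
      _ = _ := by ring
  refine limsup_le_of_le_add ?_ (h c hct) hBt
  filter_upwards [hne] with n hn
  rw [law_apply]
  calc ∫⁻ c', f n c' ∂labelLaw θ n
      ≤ ∫⁻ c', (f n (c n) + (B n).indicator 1 c') ∂labelLaw θ n := by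
        refine lintegral_mono fun c' => ?_
        by_cases hb : c' ∈ B n
        · simp only [hb, Set.indicator_of_mem, Pi.one_apply]
          exact le_add_left prob_le_one
        · exact le_add_right ((hc n hn).2 c' hb)
    _ = _ := by
        rw [lintegral_add_left measurable_const, lintegral_indicator_one .of_discrete]
        simp [hf]

theorem tendsto_law_zero {θ : Params} (h0 : 0 ≤ θ.κ) (h1 : θ.κ ≤ 1)
    (s : ∀ n : ℕ, Set (Labels n × (Pair n → Bool × Bool × Bool)))
    (h : ∀ c : ∀ n, Labels n, Tendsto (fun n => (size₁ (c n) : ℝ) / n) atTop (𝓝 θ.κ) →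
      Tendsto (fun n => pairLaw θ n (c n) (Prod.mk (c n) ⁻¹' s n)) atTop (𝓝 0)) :
    Tendsto (fun n => law θ n (s n)) atTop (𝓝 0) :=
  tendsto_zero_of_limsup_le (limsup_law_le h0 h1 s 0 fun c hc => (h c hc).limsup_eq.le)

/-! ### Numbers of pairs -/

theorem card_pair_filter {n : ℕ} (p : Fin n → Prop) [DecidablePred p] :
    (Finset.univ.filter fun e : Pair n => p e.1.1 ∧ p e.1.2).card =
      (Finset.univ.filter p).card.choose 2 := by
  rw [← Finset.card_powersetCard]
  refine Finset.card_bij (fun e _ => {e.1.1, e.1.2}) ?_ ?_ ?_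
  · intro e he
    simp only [Finset.mem_filter, Finset.mem_univ, true_and] at he
    rw [Finset.mem_powersetCard]
    refine ⟨?_, Finset.card_pair e.2.ne⟩
    intro i hi
    simp only [Finset.mem_insert, Finset.mem_singleton] at hi
    rcases hi with rfl | rfl <;> simp [he]
  · rintro ⟨⟨a, b⟩, hab⟩ _ ⟨⟨a', b'⟩, hab'⟩ _ h
    simp only at hab hab' h
    have h1 : a ∈ ({a', b'} : Finset (Fin n)) := h ▸ by simp
    have h2 : b ∈ ({a', b'} : Finset (Fin n)) := h ▸ by simp
    simp only [Finset.mem_insert, Finset.mem_singleton] at h1 h2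
    simp only [Subtype.mk.injEq, Prod.mk.injEq]
    omega
  · intro t ht
    rw [Finset.mem_powersetCard, Finset.card_eq_two] at ht
    obtain ⟨hsub, x, y, hxy, rfl⟩ := ht
    have hx : p x := by simpa using hsub (Finset.mem_insert_self x {y})
    have hy : p y := by simpa using hsub (Finset.mem_insert_of_mem (Finset.mem_singleton_self y))
    rcases lt_or_gt_of_ne hxy with h | h
    · exact ⟨⟨(x, y), h⟩, by simp [hx, hy], rfl⟩
    · exact ⟨⟨(y, x), h⟩, by simp [hx, hy], Finset.pair_comm _ _⟩

theorem block_eq_one {n : ℕ} (c : Labels n) (e : Pair n) :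
    block c e = .one ↔ c e.1.1 = true ∧ c e.1.2 = true := by
  unfold block
  split <;> simp_all

theorem block_eq_two {n : ℕ} (c : Labels n) (e : Pair n) :
    block c e = .two ↔ c e.1.1 = false ∧ c e.1.2 = false := by
  unfold block
  split <;> simp_all

theorem card_block {n : ℕ} (c : Labels n) (k : Block) :
    ((Finset.univ.filter fun e : Pair n => block c e = k).card : ℝ) = numPairs c k := by
  have hone : (Finset.univ.filter fun e : Pair n => block c e = .one).card =
      (size₁ c).choose 2 := by
    rw [size₁, ← card_pair_filter]
    simp only [block_eq_one]
  have htwo : (Finset.univ.filter fun e : Pair n => block c e = .two).card =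
      (size₂ c).choose 2 := by
    rw [size₂, ← card_pair_filter]
    simp only [block_eq_two]
  cases k with
  | one => simp only [numPairs, hone]
  | two => simp only [numPairs, htwo]
  | between =>
    have hall : Fintype.card (Pair n) = n.choose 2 := by
      have := card_pair_filter (n := n) fun _ => True
      simpa using this
    have hsum : (Finset.univ.filter fun e : Pair n => block c e = .one).card +
        (Finset.univ.filter fun e : Pair n => block c e = .two).card +
        (Finset.univ.filter fun e : Pair n => block c e = .between).card = n.choose 2 := by
      rw [← hall, ← Finset.card_univ, Finset.card_filter, Finset.card_filter, Finset.card_filter,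
        ← Finset.sum_add_distrib, ← Finset.sum_add_distrib, Finset.card_eq_sum_ones]
      refine Finset.sum_congr rfl fun e _ => ?_
      cases block c e <;> simp
    rw [hone, htwo] at hsum
    have hs := size₁_add_size₂ c
    have hsum' : ((size₁ c).choose 2 : ℝ) + ((size₂ c).choose 2 : ℝ) +
        ((Finset.univ.filter fun e : Pair n => block c e = .between).card : ℝ) =
        ((size₁ c + size₂ c).choose 2 : ℕ) := by
      rw [hs]; exact_mod_cast hsum
    rw [Nat.cast_choose_two, Nat.cast_choose_two, Nat.cast_choose_two] at hsum'
    simp only [numPairs]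
    push_cast at hsum' ⊢
    linarith

/-- The limits of `N_x / n²`. -/
def pairFrac (θ : Params) : Block → ℝ
  | .one => θ.κ ^ 2 / 2
  | .two => (1 - θ.κ) ^ 2 / 2
  | .between => θ.κ * (1 - θ.κ)

theorem pairFrac_pos {θ : Params} (h0 : 0 < θ.κ) (h1 : θ.κ < 1) (k : Block) :
    0 < pairFrac θ k := by
  have : 0 < 1 - θ.κ := by linarith
  cases k <;> simp only [pairFrac] <;> positivity

theorem tendsto_numPairs_div {θ : Params} {c : ∀ n, Labels n}
    (hc : Tendsto (fun n => (size₁ (c n) : ℝ) / n) atTop (𝓝 θ.κ)) (k : Block) :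
    Tendsto (fun n => numPairs (c n) k / (n : ℝ) ^ 2) atTop (𝓝 (pairFrac θ k)) := by
  have hinv : Tendsto (fun n : ℕ => 1 / (n : ℝ)) atTop (𝓝 0) := tendsto_one_div_atTop_nhds_zero_nat
  have hc2 : Tendsto (fun n => (size₂ (c n) : ℝ) / n) atTop (𝓝 (1 - θ.κ)) := by
    refine (hc.const_sub 1).congr' ?_
    filter_upwards [eventually_gt_atTop 0] with n hn
    have hn' : (n : ℝ) ≠ 0 := by exact_mod_cast hn.ne'
    have : (size₁ (c n) : ℝ) + size₂ (c n) = n := by exact_mod_cast size₁_add_size₂ (c n)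
    field_simp
    linarith
  have key : ∀ {m : ℕ → ℕ} {a : ℝ}, Tendsto (fun n => (m n : ℝ) / n) atTop (𝓝 a) →
      Tendsto (fun n => (((m n).choose 2 : ℕ) : ℝ) / (n : ℝ) ^ 2) atTop (𝓝 (a ^ 2 / 2)) := by
    intro m a hm
    have h := (hm.mul (hm.sub hinv)).div_const 2
    rw [sub_zero, ← sq] at h
    refine h.congr' ?_
    filter_upwards [eventually_gt_atTop 0] with n hn
    have hn' : (n : ℝ) ≠ 0 := by exact_mod_cast hn.ne'
    rw [Nat.cast_choose_two]
    field_simp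
  cases k with
  | one => exact key hc
  | two => exact key hc2
  | between =>
    refine (hc.mul hc2).congr fun n => ?_
    simp only [numPairs]
    push_cast
    rw [div_mul_div_comm, sq]

theorem tendsto_sq_div_numPairs {θ : Params} (h0 : 0 < θ.κ) (h1 : θ.κ < 1) {c : ∀ n, Labels n}
    (hc : Tendsto (fun n => (size₁ (c n) : ℝ) / n) atTop (𝓝 θ.κ)) (k : Block) :
    Tendsto (fun n : ℕ => (n : ℝ) ^ 2 / numPairs (c n) k) atTop (𝓝 (pairFrac θ k)⁻¹) := by
  refine ((tendsto_numPairs_div hc k).inv₀ (pairFrac_pos h0 h1 k).ne').congr fun n => ?_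
  rw [inv_div]

theorem eventually_numPairs_pos {θ : Params} (h0 : 0 < θ.κ) (h1 : θ.κ < 1) {c : ∀ n, Labels n}
    (hc : Tendsto (fun n => (size₁ (c n) : ℝ) / n) atTop (𝓝 θ.κ)) (k : Block) :
    ∀ᶠ n in atTop, 0 < numPairs (c n) k := by
  filter_upwards [(tendsto_numPairs_div hc k).eventually_const_lt (pairFrac_pos h0 h1 k)] with n hn
  by_contra hcon
  exact absurd hn (not_lt.2 (div_nonpos_of_nonpos_of_nonneg (not_lt.1 hcon) (sq_nonneg _)))

/-! ### Moments of a single pair -/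

theorem integral_edgeLaw (p b : ℝ) (f : Bool × Bool × Bool → ℝ) :
    ∫ w, f w ∂edgeLaw p b =
      toUnit p * (toUnit b * (toUnit b * f (true, false, false) +
          (1 - toUnit b) * f (true, false, true)) +
        (1 - toUnit b) * (toUnit b * f (true, true, false) +
          (1 - toUnit b) * f (true, true, true))) +
      (1 - toUnit p) * f (false, false, false) := by
  have : IsMarkovKernel (Kernel.ofFunOfCountable fun a : Bool => (obsLaw b a).prod (obsLaw b a)) :=
    ⟨fun a => inferInstanceAs (IsProbabilityMeasure ((obsLaw b a).prod (obsLaw b a)))⟩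
  rw [edgeLaw, Measure.integral_compProd Integrable.of_finite, integral_bernoulliMeasure]
  change _ • ∫ y, f (true, y) ∂(obsLaw b true).prod (obsLaw b true) +
    _ • ∫ y, f (false, y) ∂(obsLaw b false).prod (obsLaw b false) = _
  rw [integral_prod _ Integrable.of_finite, integral_prod _ Integrable.of_finite]
  simp [obsLaw, integral_bernoulliMeasure]

instance : Fintype Block := ⟨{.one, .two, .between}, fun k => by cases k <;> simp⟩

theorem sum_block {M : Type*} [AddCommMonoid M] (f : Block → M) :
    ∑ k, f k = f .one + f .two + f .between := by
  change ∑ k ∈ {.one, .two, .between}, f k = _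
  rw [Finset.sum_insert (by simp), Finset.sum_insert (by simp), Finset.sum_singleton, add_assoc]

/-- Mean of `Y_ij` in a block. -/
def mean₁ (θ : Params) (n : ℕ) (k : Block) : ℝ :=
  (1 - toUnit (errProb θ n k)) * toUnit (edgeProb θ n k)

/-- Mean of `|Y_ij - Y*_ij| / 2` in a block. -/
def mean₂ (θ : Params) (n : ℕ) (k : Block) : ℝ :=
  toUnit (errProb θ n k) * mean₁ θ n k

/-- The combination of the centred `Y_ij` and `|Y_ij - Y*_ij| / 2` with coefficients `a` and `b`;
`x` and `y` are the means. -/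
def pairScore (x y a b : ℝ) (w : Bool × Bool × Bool) : ℝ :=
  a * (entry w.2.1 - x) + b * (|entry w.2.1 - entry w.2.2| / 2 - y)

/-- The quadratic form of `SigmaU x y` at `(a, b)`. -/
def pairVar (x y a b : ℝ) : ℝ :=
  a ^ 2 * (x * (1 - x)) + 2 * (a * b) * ((1 / 2 - x) * y) + b ^ 2 * ((1 / 2 - y) * y)

theorem integral_pairScore (θ : Params) (n : ℕ) (k : Block) (a b : ℝ) :
    ∫ w, pairScore (mean₁ θ n k) (mean₂ θ n k) a b w
      ∂edgeLaw (edgeProb θ n k) (errProb θ n k) = 0 := by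
  rw [integral_edgeLaw]
  simp only [pairScore, entry, mean₂, mean₁]
  norm_num
  ring

theorem integral_pairScore_sq (θ : Params) (n : ℕ) (k : Block) (a b : ℝ) :
    ∫ w, pairScore (mean₁ θ n k) (mean₂ θ n k) a b w ^ 2
      ∂edgeLaw (edgeProb θ n k) (errProb θ n k) = pairVar (mean₁ θ n k) (mean₂ θ n k) a b := by
  rw [integral_edgeLaw]
  simp only [pairScore, pairVar, entry, mean₂, mean₁]
  norm_num
  ring

theorem mean₁_mem (θ : Params) (n : ℕ) (k : Block) : 0 ≤ mean₁ θ n k ∧ mean₁ θ n k ≤ 1 := by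
  have hb := (toUnit (errProb θ n k)).2
  have hp := (toUnit (edgeProb θ n k)).2
  exact ⟨mul_nonneg (by linarith [hb.2]) hp.1,
    mul_le_one₀ (by linarith [hb.1]) hp.1 hp.2⟩

theorem mean₂_mem (θ : Params) (n : ℕ) (k : Block) : 0 ≤ mean₂ θ n k ∧ mean₂ θ n k ≤ 1 := by
  have hb := (toUnit (errProb θ n k)).2
  have hm := mean₁_mem θ n k
  exact ⟨mul_nonneg hb.1 hm.1, mul_le_one₀ hb.2 hm.1 hm.2⟩

theorem abs_pairScore_le {x y : ℝ} (hx : 0 ≤ x ∧ x ≤ 1) (hy : 0 ≤ y ∧ y ≤ 1) (a b : ℝ)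
    (w : Bool × Bool × Bool) : |pairScore x y a b w| ≤ |a| + |b| := by
  have h1 : |entry w.2.1 - x| ≤ 1 := by
    unfold entry
    rw [abs_le]
    split_ifs <;> constructor <;> linarith [hx.1, hx.2]
  have h2 : |(|entry w.2.1 - entry w.2.2| / 2 - y)| ≤ 1 := by
    unfold entry
    rw [abs_le]
    split_ifs <;> norm_num <;> constructor <;> linarith [hy.1, hy.2]
  rw [pairScore]
  refine (abs_add_le _ _).trans ?_
  rw [abs_mul, abs_mul]
  exact add_le_add (mul_le_of_le_one_right (abs_nonneg _) h1)
    (mul_le_of_le_one_right (abs_nonneg _) h2)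

theorem continuous_toUnit : Continuous toUnit :=
  continuous_projIcc (h := zero_le_one)

theorem tendsto_const_div_sqrt (a : ℝ) : Tendsto (fun n : ℕ => a / √(n : ℝ)) atTop (𝓝 0) :=
  Tendsto.const_div_atTop (Real.tendsto_sqrt_atTop.comp tendsto_natCast_atTop_atTop) a

theorem tendsto_toUnit_edgeProb {θ : Params} (hθ : InModel θ) (k : Block) :
    Tendsto (fun n => (toUnit (edgeProb θ n k) : ℝ)) atTop (𝓝 θ.q) := by
  obtain ⟨-, -, hq0, hq1, -, -⟩ := hθ
  have h : Tendsto (fun n => edgeProb θ n k) atTop (𝓝 θ.q) := by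
    cases k
    · simpa [edgeProb] using (tendsto_const_div_sqrt θ.μ₁).const_add θ.q
    · simpa [edgeProb] using (tendsto_const_div_sqrt θ.μ₂).const_add θ.q
    · exact tendsto_const_nhds
  have := ((continuous_subtype_val.comp continuous_toUnit).tendsto θ.q).comp h
  simpa [Function.comp_def, coe_toUnit hq0.le hq1.le] using this

theorem tendsto_toUnit_errProb {θ : Params} (hθ : InModel θ) (k : Block) :
    Tendsto (fun n => (toUnit (errProb θ n k) : ℝ)) atTop (𝓝 θ.β) := by
  obtain ⟨-, -, -, -, hb0, hb1⟩ := hθ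
  have h : Tendsto (fun n => errProb θ n k) atTop (𝓝 θ.β) := by
    cases k
    · simpa [errProb] using (tendsto_const_div_sqrt θ.γ₁).const_sub θ.β
    · simpa [errProb] using (tendsto_const_div_sqrt θ.γ₂).const_sub θ.β
    · exact tendsto_const_nhds
  have := ((continuous_subtype_val.comp continuous_toUnit).tendsto θ.β).comp h
  simpa [Function.comp_def, coe_toUnit hb0 hb1.le] using this

theorem tendsto_mean₁ {θ : Params} (hθ : InModel θ) (k : Block) :
    Tendsto (fun n => mean₁ θ n k) atTop (𝓝 (qStar θ)) :=
  ((tendsto_toUnit_errProb hθ k).const_sub 1).mul (tendsto_toUnit_edgeProb hθ k)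

theorem tendsto_mean₂ {θ : Params} (hθ : InModel θ) (k : Block) :
    Tendsto (fun n => mean₂ θ n k) atTop (𝓝 (θ.β * qStar θ)) :=
  (tendsto_toUnit_errProb hθ k).mul (tendsto_mean₁ hθ k)

/-! ### Fluctuations of the moment estimators -/

/-- A sample `(c, (A, Y, Y*))` on `n` nodes. -/
abbrev Sample (n : ℕ) : Type := Labels n × (Pair n → Bool × Bool × Bool)

/-- The vector of moment estimators, in the order `(û_{1,1}, û_{2,1}, û_{1,2}, û_{2,2}, û_{1,b},
û_{2,b})`. -/
def momentVec {n : ℕ} (d : Data n) : Fin 6 → ℝ :=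
  ![u₁ d .one, u₂ d .one, u₁ d .two, u₂ d .two, u₁ d .between, u₂ d .between]

/-- The conditional mean of `momentVec` given labels for which no block is empty. -/
def meanVec (θ : Params) (n : ℕ) : Fin 6 → ℝ :=
  ![mean₁ θ n .one, mean₂ θ n .one, mean₁ θ n .two, mean₂ θ n .two,
    mean₁ θ n .between, mean₂ θ n .between]

/-- The limit of `meanVec`. -/
def limitVec (θ : Params) : Fin 6 → ℝ :=
  ![qStar θ, θ.β * qStar θ, qStar θ, θ.β * qStar θ, qStar θ, θ.β * qStar θ]

/-- The centred moment estimators, scaled by `n`. -/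
def fluct (θ : Params) (n : ℕ) (ω : Sample n) : Fin 6 → ℝ :=
  fun j => n * (momentVec (observe ω) j - meanVec θ n j)

/-- The coefficient of the first moment of a block. -/
def coef₁ (t : Fin 6 → ℝ) : Block → ℝ
  | .one => t 0
  | .two => t 2
  | .between => t 4

/-- The coefficient of the second moment of a block. -/
def coef₂ (t : Fin 6 → ℝ) : Block → ℝ
  | .one => t 1
  | .two => t 3
  | .between => t 5

/-- The contribution of a pair of a given block to `∑ j, t j * fluct θ n ω j`. -/
def pairTerm (θ : Params) (n : ℕ) (c : Labels n) (t : Fin 6 → ℝ) (k : Block)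
    (w : Bool × Bool × Bool) : ℝ :=
  n / numPairs c k * pairScore (mean₁ θ n k) (mean₂ θ n k) (coef₁ t k) (coef₂ t k) w

theorem sum_pair_eq_sum_block {n : ℕ} (c : Labels n) (f : Pair n → ℝ) :
    ∑ e, f e = ∑ k, ∑ e with block c e = k, f e :=
  (Finset.sum_fiberwise _ _ _).symm

theorem sum_pairTerm {θ : Params} {n : ℕ} {c : Labels n} (hc : ∀ k, numPairs c k ≠ 0)
    (t : Fin 6 → ℝ) (w : Pair n → Bool × Bool × Bool) :
    ∑ e, pairTerm θ n c t (block c e) (w e) = ∑ j, t j * fluct θ n (c, w) j := by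
  have hk : ∀ k, ∑ e with block c e = k, pairTerm θ n c t (block c e) (w e) =
      n * (coef₁ t k * (u₁ (observe (c, w)) k - mean₁ θ n k) +
        coef₂ t k * (u₂ (observe (c, w)) k - mean₂ θ n k)) := by
    intro k
    have h1 : ∑ e with block c e = k, pairTerm θ n c t (block c e) (w e) =
        ∑ e with block c e = k, (n / numPairs c k) * (coef₁ t k * entry (w e).2.1 +
          coef₂ t k / 2 * |entry (w e).2.1 - entry (w e).2.2| -
          (coef₁ t k * mean₁ θ n k + coef₂ t k * mean₂ θ n k)) := by
      refine Finset.sum_congr rfl fun e he => ?_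
      rw [(Finset.mem_filter.1 he).2, pairTerm, pairScore]
      ring
    rw [h1, ← Finset.mul_sum, Finset.sum_sub_distrib, Finset.sum_add_distrib, ← Finset.mul_sum,
      ← Finset.mul_sum, Finset.sum_const, nsmul_eq_mul, card_block]
    have hu₁ : u₁ (observe (c, w)) k =
        1 / numPairs c k * ∑ e with block c e = k, entry (w e).2.1 := rfl
    have hu₂ : u₂ (observe (c, w)) k =
        1 / (2 * numPairs c k) *
          ∑ e with block c e = k, |entry (w e).2.1 - entry (w e).2.2| := rfl
    rw [hu₁, hu₂]
    have := hc k
    field_simp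
    ring
  rw [sum_pair_eq_sum_block c]
  simp_rw [hk]
  rw [sum_block, Fin.sum_univ_six]
  simp only [fluct, momentVec, meanVec, coef₁, coef₂]
  simp
  ring

/-- The conditional variance of `∑ j, t j * fluct θ n ω j`. -/
def fluctVar (θ : Params) (n : ℕ) (c : Labels n) (t : Fin 6 → ℝ) : ℝ :=
  ∑ k, (n : ℝ) ^ 2 / numPairs c k * pairVar (mean₁ θ n k) (mean₂ θ n k) (coef₁ t k) (coef₂ t k)

theorem sum_integral_pairTerm_sq {θ : Params} {n : ℕ} {c : Labels n}
    (hc : ∀ k, numPairs c k ≠ 0) (t : Fin 6 → ℝ) :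
    ∑ e : Pair n, ∫ w, pairTerm θ n c t (block c e) w ^ 2
      ∂edgeLaw (edgeProb θ n (block c e)) (errProb θ n (block c e)) = fluctVar θ n c t := by
  rw [sum_pair_eq_sum_block c, fluctVar]
  refine Finset.sum_congr rfl fun k _ => ?_
  have h : ∀ e ∈ Finset.univ.filter (fun e : Pair n => block c e = k),
      ∫ w, pairTerm θ n c t (block c e) w ^ 2
        ∂edgeLaw (edgeProb θ n (block c e)) (errProb θ n (block c e)) =
      (n / numPairs c k) ^ 2 *
        pairVar (mean₁ θ n k) (mean₂ θ n k) (coef₁ t k) (coef₂ t k) := by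
    intro e he
    rw [(Finset.mem_filter.1 he).2]
    simp only [pairTerm, mul_pow]
    rw [integral_const_mul, integral_pairScore_sq]
  rw [Finset.sum_congr rfl h, Finset.sum_const, nsmul_eq_mul, card_block]
  have := hc k
  field_simp

theorem integral_pairTerm (θ : Params) (n : ℕ) (c : Labels n) (t : Fin 6 → ℝ) (k : Block) :
    ∫ w, pairTerm θ n c t k w ∂edgeLaw (edgeProb θ n k) (errProb θ n k) = 0 := by
  simp only [pairTerm]
  rw [integral_const_mul, integral_pairScore, mul_zero]

theorem abs_pairTerm_le (θ : Params) (n : ℕ) (c : Labels n) (t : Fin 6 → ℝ) (k : Block)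
    (w : Bool × Bool × Bool) :
    |pairTerm θ n c t k w| ≤ ∑ l, |n / numPairs c l| * (|coef₁ t l| + |coef₂ t l|) := by
  rw [pairTerm, abs_mul]
  refine le_trans (mul_le_mul_of_nonneg_left
    (abs_pairScore_le (mean₁_mem θ n k) (mean₂_mem θ n k) _ _ w) (abs_nonneg _)) ?_
  exact Finset.single_le_sum (f := fun l => |n / numPairs c l| * (|coef₁ t l| + |coef₂ t l|))
    (fun l _ => by positivity) (Finset.mem_univ k)

theorem limit_fluctVar_eq (θ : Params) (t : Fin 6 → ℝ) :
    ∑ k, (pairFrac θ k)⁻¹ * pairVar (qStar θ) (θ.β * qStar θ) (coef₁ t k) (coef₂ t k) =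
      quadForm (momentCov θ) t := by
  rw [sum_block]
  simp only [pairFrac, coef₁, coef₂, pairVar, quadForm, momentCov, blockDiag, SigmaU, dotProduct,
    Matrix.mulVec, Fin.sum_univ_six]
  simp
  ring

section Conditional

variable {θ : Params} {c : ∀ n, Labels n}

theorem tendsto_fluctVar (hθ : InModel θ)
    (hc : Tendsto (fun n => (size₁ (c n) : ℝ) / n) atTop (𝓝 θ.κ)) (t : Fin 6 → ℝ) :
    Tendsto (fun n => fluctVar θ n (c n) t) atTop (𝓝 (quadForm (momentCov θ) t)) := by
  have hκ1 : θ.κ < 1 := by linarith [hθ.2.1]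
  rw [← limit_fluctVar_eq]
  refine tendsto_finsetSum _ fun k _ => (tendsto_sq_div_numPairs hθ.1 hκ1 hc k).mul ?_
  have h1 := tendsto_mean₁ hθ k
  have h2 := tendsto_mean₂ hθ k
  unfold pairVar
  exact (((h1.mul (h1.const_sub 1)).const_mul _).add (((h1.const_sub _).mul h2).const_mul _)).add
    (((h2.const_sub _).mul h2).const_mul _)

theorem eventually_numPairs_ne (hθ : InModel θ)
    (hc : Tendsto (fun n => (size₁ (c n) : ℝ) / n) atTop (𝓝 θ.κ)) :
    ∀ᶠ n in atTop, ∀ k, numPairs (c n) k ≠ 0 := by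
  have hκ1 : θ.κ < 1 := by linarith [hθ.2.1]
  rw [Filter.eventually_all]
  exact fun k => (eventually_numPairs_pos hθ.1 hκ1 hc k).mono fun n hn => hn.ne'

/-- Conditional central limit theorem for the moment estimators, for characteristic functions. -/
theorem tendsto_charFun_fluct (hθ : InModel θ)
    (hc : Tendsto (fun n => (size₁ (c n) : ℝ) / n) atTop (𝓝 θ.κ)) (t : Fin 6 → ℝ) :
    Tendsto (fun n => ∫ w, Complex.exp (Complex.I * ((∑ j, t j * fluct θ n (c n, w) j : ℝ) : ℂ))
      ∂pairLaw θ n (c n)) atTop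
      (𝓝 (Complex.exp (-((quadForm (momentCov θ) t : ℝ) : ℂ) / 2))) := by
  have hκ1 : θ.κ < 1 := by linarith [hθ.2.1]
  have hV := tendsto_fluctVar hθ hc t
  have hg : Tendsto (fun n => Complex.exp (-((fluctVar θ n (c n) t : ℝ) : ℂ) / 2)) atTop
      (𝓝 (Complex.exp (-((quadForm (momentCov θ) t : ℝ) : ℂ) / 2))) := by
    have hcont : Continuous fun v : ℝ => Complex.exp (-(v : ℂ) / 2) := by fun_prop
    exact (hcont.tendsto _).comp hV
  -- a uniform bound on the terms, of order `1 / n`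
  set δ : ℕ → ℝ := fun n => ∑ l, |n / numPairs (c n) l| * (|coef₁ t l| + |coef₂ t l|) with hδdef
  have hδ : Tendsto δ atTop (𝓝 0) := by
    have : ∀ l, Tendsto (fun n : ℕ => |n / numPairs (c n) l| * (|coef₁ t l| + |coef₂ t l|)) atTop
        (𝓝 0) := by
      intro l
      have h := ((tendsto_sq_div_numPairs hθ.1 hκ1 hc l).mul
        tendsto_one_div_atTop_nhds_zero_nat).abs.mul_const (|coef₁ t l| + |coef₂ t l|)
      rw [mul_zero, abs_zero, zero_mul] at h
      refine h.congr fun n => ?_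
      rcases eq_or_ne (n : ℝ) 0 with hn | hn
      · simp [hn]
      · congr 2; field_simp
    simpa using tendsto_finsetSum Finset.univ fun l _ => this l
  have hbound : Tendsto (fun n => 2 * δ n * fluctVar θ n (c n) t) atTop (𝓝 0) := by
    simpa using (hδ.const_mul 2).mul hV
  have hdiff : Tendsto (fun n => (∫ w, Complex.exp (Complex.I *
        ((∑ j, t j * fluct θ n (c n, w) j : ℝ) : ℂ)) ∂pairLaw θ n (c n)) -
      Complex.exp (-((fluctVar θ n (c n) t : ℝ) : ℂ) / 2)) atTop (𝓝 0) := by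
    refine squeeze_zero_norm' ?_ hbound
    filter_upwards [eventually_numPairs_ne hθ hc, hδ.eventually_le_const zero_lt_one] with n hn hδn
    simp_rw [← sum_pairTerm hn t]
    rw [← sum_integral_pairTerm_sq hn t, pairLaw]
    exact norm_integral_exp_sum_sub_exp_le
      (η := fun e : Pair n => pairTerm θ n (c n) t (block (c n) e))
      (fun e => Measurable.of_discrete) hδn (fun e w => abs_pairTerm_le θ n (c n) t _ w)
      (fun e => integral_pairTerm θ n (c n) t _)
  simpa using hdiff.add hg

/-- Chebyshev's inequality for the fluctuations, given the labels. -/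
theorem pairLaw_fluct_le {n : ℕ} {c : Labels n} (hc : ∀ k, numPairs c k ≠ 0) (t : Fin 6 → ℝ)
    {B : ℝ} (hB : 0 < B) :
    pairLaw θ n c {w | B ≤ |∑ j, t j * fluct θ n (c, w) j|} ≤
      ENNReal.ofReal (fluctVar θ n c t / B ^ 2) := by
  set X : (Pair n → Bool × Bool × Bool) → ℝ :=
    ∑ e, fun w => pairTerm θ n c t (block c e) (w e) with hX
  have hvar : Var[X; pairLaw θ n c] ≤ fluctVar θ n c t := by
    rw [hX, pairLaw, variance_sum_pi (X := fun e : Pair n => pairTerm θ n c t (block c e))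
      fun e => MemLp.of_discrete, ← sum_integral_pairTerm_sq hc]
    exact Finset.sum_le_sum fun e _ => variance_le_expectation_sq (by fun_prop)
  have hmean : ∫ w, X w ∂pairLaw θ n c = 0 := by
    simp only [hX, Finset.sum_apply]
    rw [integral_finsetSum _ fun _ _ => Integrable.of_finite]
    refine Finset.sum_eq_zero fun e _ => ?_
    rw [pairLaw, integral_comp_eval (μ := fun e : Pair n =>
      edgeLaw (edgeProb θ n (block c e)) (errProb θ n (block c e)))
      (f := pairTerm θ n c t (block c e)) (by fun_prop), integral_pairTerm]
  have h := meas_ge_le_variance_div_sq (μ := pairLaw θ n c) (X := X) MemLp.of_discrete hB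
  rw [hmean] at h
  refine le_trans (le_of_eq ?_) (h.trans (ENNReal.ofReal_le_ofReal (by gcongr)))
  congr 1 with w
  simp only [Set.mem_ofPred_eq, sub_zero, hX, Finset.sum_apply]
  rw [sum_pairTerm hc]

end Conditional

theorem limsup_law_fluct_le {θ : Params} (hθ : InModel θ) (t : Fin 6 → ℝ) {B : ℝ} (hB : 0 < B) :
    limsup (fun n => law θ n {ω | B ≤ |∑ j, t j * fluct θ n ω j|}) atTop ≤
      ENNReal.ofReal (quadForm (momentCov θ) t / B ^ 2) := by
  refine limsup_law_le hθ.1.le (by linarith [hθ.2.1]) _ _ fun c hc => ?_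
  have hlim := (ENNReal.tendsto_ofReal ((tendsto_fluctVar hθ hc t).div_const (B ^ 2)))
  rw [← hlim.limsup_eq]
  refine limsup_le_limsup ?_
  filter_upwards [eventually_numPairs_ne hθ hc] with n hn
  exact pairLaw_fluct_le hn t hB

open scoped MatrixOrder Matrix.Norms.L2Operator in
theorem exists_isUnit_eq_transpose_mul_self {m : ℕ} {P : Matrix (Fin m) (Fin m) ℝ}
    (hP : P.PosDef) : ∃ C : Matrix (Fin m) (Fin m) ℝ, IsUnit C ∧ P = C.transpose * C := by
  obtain ⟨C, hC, h⟩ := CStarAlgebra.isStrictlyPositive_iff_eq_star_mul_self.mp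
    hP.isStrictlyPositive
  exact ⟨C, hC, by
    rw [h, Matrix.star_eq_conjTranspose, Matrix.conjTranspose_eq_transpose_of_trivial]⟩

/-- Writing `(D S Dᵀ)⁻¹ = Cᵀ C`, the vector `C D Z` with `Z = fluct` is asymptotically standard
normal, and its squared norm is the standardised quadratic form of `D Z`. -/
theorem limsup_law_quadForm_le {θ : Params} (hθ : InModel θ) {m : ℕ}
    {D : Matrix (Fin m) (Fin 6) ℝ} (hD : (D * momentCov θ * D.transpose).PosDef) (x : ℝ) :
    limsup (fun n => law θ n
      {ω | x ≤ quadForm (D * momentCov θ * D.transpose)⁻¹ (D.mulVec (fluct θ n ω))}) atTop ≤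
      chiSquared m (Set.Ici x) := by
  obtain ⟨C, hC, hCC⟩ := exists_isUnit_eq_transpose_mul_self hD.inv
  have hCdet : IsUnit C.det := (Matrix.isUnit_iff_isUnit_det C).1 hC
  have hId : C * (D * momentCov θ * D.transpose) * C.transpose = 1 := by
    have hS : D * momentCov θ * D.transpose = C⁻¹ * C.transpose⁻¹ := by
      rw [← Matrix.mul_inv_rev, ← hCC, Matrix.nonsing_inv_nonsing_inv]
      exact (Matrix.isUnit_iff_isUnit_det _).1 hD.isUnit
    have hCt : IsUnit C.transpose.det := by rwa [Matrix.det_transpose]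
    rw [hS, ← Matrix.mul_assoc, Matrix.mul_nonsing_inv _ hCdet, Matrix.one_mul,
      Matrix.nonsing_inv_mul _ hCt]
  have hsq : ∀ z : Fin 6 → ℝ, quadForm (D * momentCov θ * D.transpose)⁻¹ (D.mulVec z) =
      ∑ i, (C * D).mulVec z i ^ 2 := by
    intro z
    rw [quadForm, hCC, ← Matrix.mulVec_mulVec, Matrix.mulVec_transpose, dotProduct_comm,
      ← Matrix.dotProduct_mulVec, Matrix.mulVec_mulVec]
    simp [dotProduct, sq]
  simp_rw [hsq]
  refine limsup_law_le hθ.1.le (by linarith [hθ.2.1]) _ _ fun c hc => ?_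
  refine limsup_measure_sum_sq_ge_le (fun n => pairLaw θ n (c n))
    (fun n w => (C * D).mulVec (fluct θ n (c n, w))) (fun n => Measurable.of_discrete) ?_ x
  intro s
  have h := tendsto_charFun_fluct hθ hc ((C * D).transpose.mulVec s)
  have hv : quadForm (momentCov θ) ((C * D).transpose.mulVec s) = ∑ i, s i ^ 2 := by
    rw [quadForm, Matrix.mulVec_transpose, ← Matrix.dotProduct_mulVec, ← Matrix.mulVec_transpose,
      Matrix.mulVec_mulVec, Matrix.mulVec_mulVec, Matrix.transpose_mul, ← Matrix.mul_assoc]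
    rw [show C * D * momentCov θ * D.transpose * C.transpose =
      C * (D * momentCov θ * D.transpose) * C.transpose by simp only [Matrix.mul_assoc], hId]
    simp [dotProduct, sq]
  rw [hv] at h
  refine h.congr fun n => ?_
  congr 1 with w
  congr 3
  change (C * D).transpose.mulVec s ⬝ᵥ fluct θ n (c n, w) = s ⬝ᵥ (C * D).mulVec _
  rw [Matrix.mulVec_transpose, ← Matrix.dotProduct_mulVec]

/-! ### Convergence in probability along a sequence of probability spaces -/

section ConvProb

variable {Ω : ℕ → Type*} [∀ n, MeasurableSpace (Ω n)]

/-- Convergence in probability to a constant; the `n`-th variable lives on the `n`-th space. No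
measurability is required, the measures being used as outer measures. -/
def ConvProb (μ : ∀ n, Measure (Ω n)) {E : Type*} [PseudoMetricSpace E] (X : ∀ n, Ω n → E)
    (a : E) : Prop :=
  ∀ ε : ℝ, 0 < ε → Tendsto (fun n => μ n {ω | ε ≤ dist (X n ω) a}) atTop (𝓝 0)

/-- Boundedness in probability. -/
def TightSeq (μ : ∀ n, Measure (Ω n)) (X : ∀ n, Ω n → ℝ) : Prop :=
  ∀ ε : NNReal, 0 < ε → ∃ B : ℝ, 0 < B ∧ limsup (fun n => μ n {ω | B ≤ |X n ω|}) atTop ≤ ε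

variable {μ : ∀ n, Measure (Ω n)}

theorem tendsto_measure_zero_of_subset {s t : ∀ n, Set (Ω n)}
    (ht : Tendsto (fun n => μ n (t n)) atTop (𝓝 0)) (h : ∀ᶠ n in atTop, s n ⊆ t n) :
    Tendsto (fun n => μ n (s n)) atTop (𝓝 0) :=
  tendsto_of_tendsto_of_tendsto_of_le_of_le' tendsto_const_nhds ht (.of_forall fun _ => zero_le)
    (h.mono fun _ hn => measure_mono hn)

variable {E F : Type*} [PseudoMetricSpace E] [PseudoMetricSpace F]

theorem ConvProb.congr {X Y : ∀ n, Ω n → E} {a : E} (hX : ConvProb μ X a)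
    (h : ∀ᶠ n in atTop, ∀ ω, X n ω = Y n ω) : ConvProb μ Y a := fun ε hε =>
  tendsto_measure_zero_of_subset (hX ε hε) (h.mono fun n hn ω hω => by
    rw [Set.mem_ofPred_eq] at hω ⊢; rwa [hn ω])

theorem ConvProb.measure_notMem {X : ∀ n, Ω n → E} {a : E} (hX : ConvProb μ X a) {U : Set E}
    (hU : U ∈ 𝓝 a) : Tendsto (fun n => μ n {ω | X n ω ∉ U}) atTop (𝓝 0) := by
  obtain ⟨ε, hε, hb⟩ := Metric.mem_nhds_iff.1 hU
  refine tendsto_measure_zero_of_subset (hX ε hε) (.of_forall fun n ω hω => ?_)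
  by_contra hcon
  exact hω (hb (Metric.mem_ball.2 (not_le.1 hcon)))

/-- The continuous mapping theorem. -/
theorem ConvProb.comp {X : ∀ n, Ω n → E} {a : E} (hX : ConvProb μ X a) {f : E → F}
    (hf : ContinuousAt f a) : ConvProb μ (fun n ω => f (X n ω)) (f a) := fun ε hε => by
  refine tendsto_measure_zero_of_subset
    (hX.measure_notMem (hf.preimage_mem_nhds (Metric.ball_mem_nhds _ hε)))
    (.of_forall fun n ω hω => ?_)
  simp only [Set.mem_ofPred_eq, Set.mem_preimage, Metric.mem_ball, not_lt] at hω ⊢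
  exact hω

theorem convProb_of_tendsto {x : ℕ → E} {a : E} (h : Tendsto x atTop (𝓝 a)) :
    ConvProb μ (fun n _ => x n) a := fun ε hε => by
  refine tendsto_const_nhds.congr' ?_
  filter_upwards [h.eventually (Metric.ball_mem_nhds a hε)] with n hn
  have : {_ω : Ω n | ε ≤ dist (x n) a} = ∅ := by
    ext ω
    simpa using hn
  rw [this, measure_empty]

theorem convProb_pi {ι : Type*} [Fintype ι] {X : ∀ n, Ω n → ι → E} {a : ι → E}
    (h : ∀ i, ConvProb μ (fun n ω => X n ω i) (a i)) : ConvProb μ X a := fun ε hε => by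
  have hsum : Tendsto (fun n => ∑ i, μ n {ω | ε ≤ dist (X n ω i) (a i)}) atTop (𝓝 0) := by
    simpa using tendsto_finsetSum Finset.univ fun i _ => h i ε hε
  refine tendsto_of_tendsto_of_tendsto_of_le_of_le tendsto_const_nhds hsum (fun _ => zero_le)
    fun n => ?_
  refine le_trans (measure_mono fun ω hω => ?_) (measure_iUnion_fintype_le _ _)
  by_contra hcon
  simp only [Set.mem_iUnion, Set.mem_ofPred_eq, not_exists, not_le] at hcon
  exact absurd ((dist_pi_lt_iff hε).2 hcon) (not_lt.2 hω)

theorem ConvProb.prodMk {X : ∀ n, Ω n → E} {Y : ∀ n, Ω n → F} {a : E} {b : F}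
    (hX : ConvProb μ X a) (hY : ConvProb μ Y b) :
    ConvProb μ (fun n ω => (X n ω, Y n ω)) (a, b) := fun ε hε => by
  have hsum := (hX ε hε).add (hY ε hε)
  rw [add_zero] at hsum
  refine tendsto_of_tendsto_of_tendsto_of_le_of_le tendsto_const_nhds hsum (fun _ => zero_le)
    fun n => le_trans (measure_mono fun ω hω => ?_) (measure_union_le _ _)
  simpa [Prod.dist_eq, le_max_iff] using hω

theorem ConvProb.mul_tightSeq {A X : ∀ n, Ω n → ℝ} (hA : ConvProb μ A 0) (hX : TightSeq μ X) :
    ConvProb μ (fun n ω => A n ω * X n ω) 0 := fun ε hε => by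
  refine tendsto_zero_of_limsup_le (ENNReal.le_of_forall_pos_le_add fun δ hδ _ => ?_)
  obtain ⟨B, hB, hlim⟩ := hX δ hδ
  rw [zero_add]
  refine limsup_le_of_le_add (.of_forall fun n => ?_) hlim (hA (ε / B) (by positivity))
  refine le_trans (measure_mono fun ω hω => ?_) (measure_union_le _ _)
  by_contra hcon
  simp only [Set.mem_union, Set.mem_ofPred_eq, not_or, not_le, Real.dist_eq, sub_zero] at hcon hω
  have : |A n ω * X n ω| < ε / B * B := by
    rw [abs_mul]
    exact mul_lt_mul'' hcon.2 hcon.1 (abs_nonneg _) (abs_nonneg _)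
  rw [div_mul_cancel₀ _ hB.ne'] at this
  exact absurd hω (not_le.2 this)

theorem convProb_sum {ι : Type*} (s : Finset ι) {X : ι → ∀ n, Ω n → ℝ}
    (h : ∀ i ∈ s, ConvProb μ (X i) 0) : ConvProb μ (fun n ω => ∑ i ∈ s, X i n ω) 0 := by
  have h1 : ConvProb μ (fun n ω (i : s) => X i n ω) (fun _ => (0 : ℝ)) :=
    convProb_pi fun i => h i i.2
  have h2 := h1.comp (f := fun x : s → ℝ => ∑ i, x i) (by fun_prop)
  simp only [Finset.sum_const_zero] at h2
  refine h2.congr (.of_forall fun n ω => ?_)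
  exact Finset.sum_coe_sort s fun i => X i n ω

end ConvProb

theorem consistentAt_iff {m : ℕ} {θ : Params} {T : MatrixStat m} {M : Matrix (Fin m) (Fin m) ℝ} :
    ConsistentAt θ T M ↔
      ConvProb (law θ) (fun n (ω : Sample n) i j => T n (observe ω) i j) (fun i j => M i j) := by
  constructor
  · intro h
    refine convProb_pi fun i => convProb_pi fun j => fun ε hε => ?_
    exact tendsto_measure_zero_of_subset (h ε hε) (.of_forall fun n ω hω => ⟨i, j, hω⟩)
  · intro h ε hε
    refine tendsto_measure_zero_of_subset (h ε hε) (.of_forall fun n ω hω => ?_)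
    obtain ⟨i, j, hij⟩ := hω
    refine le_trans hij ?_
    rw [← Real.dist_eq]
    exact (dist_le_pi_dist (fun j => T n (observe ω) i j) (fun j => M i j) j).trans
      (dist_le_pi_dist (fun i j => T n (observe ω) i j) (fun i j => M i j) i)

/-! ### Boundedness in probability and laws of large numbers -/

theorem tightSeq_fluct {θ : Params} (hθ : InModel θ) (j : Fin 6) :
    TightSeq (law θ) fun n ω => fluct θ n ω j := by
  intro ε hε
  set v := quadForm (momentCov θ) (Pi.single j 1) with hv
  have hlim : Tendsto (fun B : ℝ => v / B ^ 2) atTop (𝓝 0) :=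
    tendsto_const_nhds.div_atTop (tendsto_pow_atTop two_ne_zero)
  obtain ⟨B, hB, hB0⟩ := ((hlim.eventually_le_const (show (0 : ℝ) < ε by exact_mod_cast hε)).and
    (eventually_gt_atTop 0)).exists
  refine ⟨B, hB0, ?_⟩
  have h := limsup_law_fluct_le hθ (Pi.single j 1) hB0
  simp only [Pi.single_apply, ite_mul, one_mul, zero_mul, Finset.sum_ite_eq', Finset.mem_univ,
    if_true] at h
  refine h.trans ?_
  rw [← ENNReal.ofReal_coe_nnreal]
  exact ENNReal.ofReal_le_ofReal hB

theorem tendsto_meanVec {θ : Params} (hθ : InModel θ) :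
    Tendsto (meanVec θ) atTop (𝓝 (limitVec θ)) := by
  rw [tendsto_pi_nhds]
  intro j
  fin_cases j
  exacts [tendsto_mean₁ hθ .one, tendsto_mean₂ hθ .one, tendsto_mean₁ hθ .two,
    tendsto_mean₂ hθ .two, tendsto_mean₁ hθ .between, tendsto_mean₂ hθ .between]

theorem convProb_momentVec {θ : Params} (hθ : InModel θ) :
    ConvProb (law θ) (fun _ ω => momentVec (observe ω)) (limitVec θ) := by
  refine convProb_pi fun j => ?_
  have h1 : ConvProb (law θ) (fun n ω => 1 / (n : ℝ) * fluct θ n ω j) 0 :=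
    ConvProb.mul_tightSeq (convProb_of_tendsto tendsto_one_div_atTop_nhds_zero_nat)
      (tightSeq_fluct hθ j)
  have h2 : ConvProb (law θ) (fun n _ => meanVec θ n j) (limitVec θ j) :=
    convProb_of_tendsto ((tendsto_pi_nhds.1 (tendsto_meanVec hθ)) j)
  have h3 := (h1.prodMk h2).comp (f := fun z : ℝ × ℝ => z.1 + z.2) (by fun_prop)
  rw [zero_add] at h3
  refine h3.congr ?_
  filter_upwards [eventually_gt_atTop 0] with n hn ω
  have hn' : (n : ℝ) ≠ 0 := by exact_mod_cast hn.ne'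
  simp only [fluct]
  field_simp
  ring

theorem convProb_sq_div_numPairs {θ : Params} (hθ : InModel θ) :
    ConvProb (law θ) (fun n ω k => (n : ℝ) ^ 2 / numPairs (observe ω).c k)
      (fun k => (pairFrac θ k)⁻¹) := by
  refine convProb_pi fun k ε hε => ?_
  refine tendsto_law_zero hθ.1.le (by linarith [hθ.2.1]) _ fun c hc => ?_
  refine tendsto_const_nhds.congr' ?_
  filter_upwards [(tendsto_sq_div_numPairs hθ.1 (by linarith [hθ.2.1]) hc k).eventually
    (Metric.ball_mem_nhds _ hε)] with n hn
  have : (Prod.mk (c n) ⁻¹' {ω : Sample n |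
      ε ≤ dist ((n : ℝ) ^ 2 / numPairs (observe ω).c k) (pairFrac θ k)⁻¹}) = ∅ := by
    ext w
    simpa [observe] using hn
  rw [this, measure_empty]

/-! ### Asymptotic covariance matrices -/

theorem pairVar_pos {x β : ℝ} {q : ℝ} (hx : x = (1 - β) * q) (hβ0 : 0 < β) (hβ1 : β < 1)
    (hq0 : 0 < q) (hq1 : q < 1) {a b : ℝ} (hab : ¬(a = 0 ∧ b = 0)) :
    0 < pairVar x (β * x) a b := by
  have hx0 : 0 < x := by rw [hx]; exact mul_pos (by linarith) hq0
  have hx1 : x < 1 := by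
    rw [hx]; nlinarith
  have hA : 0 < x * (1 - x) := mul_pos hx0 (by linarith)
  set y := β * x with hy
  have hy0 : 0 < y := mul_pos hβ0 hx0
  have hdet : 0 < x * (1 - x) * ((1 / 2 - y) * y) - ((1 / 2 - x) * y) ^ 2 := by
    -- affine in `q` and positive at `q = 0` and `q = 1`
    have h : x * (1 - x) * ((1 / 2 - y) * y) - ((1 / 2 - x) * y) ^ 2 =
        y * x / 4 * ((1 - q) * (2 - β) + q * β) := by
      rw [hy, hx]; ring
    rw [h]
    have : 0 < (1 - q) * (2 - β) + q * β := by
      have := mul_pos (sub_pos.2 hq1) (show 0 < 2 - β by linarith)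
      have := mul_pos hq0 hβ0
      linarith
    positivity
  have key : x * (1 - x) * pairVar x y a b = (x * (1 - x) * a + (1 / 2 - x) * y * b) ^ 2 +
      b ^ 2 * (x * (1 - x) * ((1 / 2 - y) * y) - ((1 / 2 - x) * y) ^ 2) := by
    rw [pairVar]; ring
  refine pos_of_mul_pos_right (a := x * (1 - x)) ?_ hA.le
  rw [key]
  by_cases hb : b = 0
  · have ha : a ≠ 0 := fun ha => hab ⟨ha, hb⟩
    subst hb
    have : x * (1 - x) * a ≠ 0 := mul_ne_zero hA.ne' ha
    have := sq_pos_of_ne_zero this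
    simpa using this
  · have := mul_pos (sq_pos_of_ne_zero hb) hdet
    have := sq_nonneg (x * (1 - x) * a + (1 / 2 - x) * y * b)
    linarith

theorem momentCov_posDef {θ : Params} (hθ : InModel θ) (hβ : 0 < θ.β) :
    (momentCov θ).PosDef := by
  obtain ⟨hκ0, hκ1, hq0, hq1, -, hβ1⟩ := hθ
  refine Matrix.PosDef.of_dotProduct_mulVec_pos ?_ fun t ht => ?_
  · ext i j
    fin_cases i <;> fin_cases j <;> simp [momentCov, blockDiag, SigmaU]
  · rw [star_trivial]
    change 0 < quadForm (momentCov θ) t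
    rw [← limit_fluctVar_eq]
    have hpos : ∀ k, ¬(coef₁ t k = 0 ∧ coef₂ t k = 0) →
        0 < (pairFrac θ k)⁻¹ * pairVar (qStar θ) (θ.β * qStar θ) (coef₁ t k) (coef₂ t k) :=
      fun k hk => mul_pos (inv_pos.2 (pairFrac_pos hκ0 (by linarith) k))
        (pairVar_pos rfl hβ hβ1 hq0 hq1 hk)
    have hnn : ∀ k, 0 ≤
        (pairFrac θ k)⁻¹ * pairVar (qStar θ) (θ.β * qStar θ) (coef₁ t k) (coef₂ t k) := by
      intro k
      by_cases hk : coef₁ t k = 0 ∧ coef₂ t k = 0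
      · rw [hk.1, hk.2]; simp [pairVar]
      · exact (hpos k hk).le
    obtain ⟨k, hk⟩ : ∃ k, ¬(coef₁ t k = 0 ∧ coef₂ t k = 0) := by
      by_contra! hcon
      refine ht (funext fun j => ?_)
      have h1 := hcon .one
      have h2 := hcon .two
      have h3 := hcon .between
      simp only [coef₁, coef₂] at h1 h2 h3
      fin_cases j
      exacts [h1.1, h1.2, h2.1, h2.2, h3.1, h3.2]
    exact Finset.sum_pos' (fun l _ => hnn l) ⟨k, Finset.mem_univ k, hpos k hk⟩

theorem posDef_mul_mul_transpose {m : ℕ} {S : Matrix (Fin 6) (Fin 6) ℝ} (hS : S.PosDef)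
    {D : Matrix (Fin m) (Fin 6) ℝ} (hD : ∀ v, Matrix.vecMul v D = 0 → v = 0) :
    (D * S * D.transpose).PosDef := by
  rw [← Matrix.conjTranspose_eq_transpose_of_trivial]
  refine hS.mul_mul_conjTranspose_same fun v w hvw => ?_
  have h : Matrix.vecMul (v - w) D = 0 := by
    rw [Matrix.sub_vecMul]; exact sub_eq_zero.2 hvw
  exact sub_eq_zero.1 (hD _ h)

theorem qStar_pos {θ : Params} (hθ : InModel θ) : 0 < qStar θ :=
  mul_pos (by linarith [hθ.2.2.2.2.2]) hθ.2.2.1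

theorem SigmaBeta_posDef {θ : Params} (hθ : InModel θ) (hβ : 0 < θ.β) : (SigmaBeta θ).PosDef := by
  refine posDef_mul_mul_transpose (momentCov_posDef hθ hβ) fun v hv => ?_
  have hq := (qStar_pos hθ).ne'
  have h1 := congrFun hv 1
  have h3 := congrFun hv 3
  have h5 := congrFun hv 5
  simp [Matrix.vecMul, dotProduct, Dh, Fin.sum_univ_three, hq] at h1 h3 h5
  simp [h1, h3, hq] at h5
  ext i
  fin_cases i
  exacts [h5, h1, h3]

theorem SigmaMu_posDef {θ : Params} (hθ : InModel θ) (hβ : 0 < θ.β) : (SigmaMu θ).PosDef := by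
  refine posDef_mul_mul_transpose (momentCov_posDef hθ hβ) fun v hv => ?_
  have hq := (qStar_pos hθ).ne'
  have hd : qStar θ - θ.β * qStar θ ≠ 0 := by
    have : qStar θ - θ.β * qStar θ = (1 - θ.β) * qStar θ := by ring
    rw [this]
    exact mul_ne_zero (sub_pos.2 hθ.2.2.2.2.2).ne' hq
  -- the two columns of a within-group block determine the two coefficients of that group
  have key : ∀ a b : ℝ, a * (θ.β * qStar θ / qStar θ ^ 2) + b * (qStar θ * (qStar θ -
        2 * (θ.β * qStar θ)) / (qStar θ - θ.β * qStar θ) ^ 2) = 0 →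
      a * (-1 / qStar θ) + b * (qStar θ ^ 2 / (qStar θ - θ.β * qStar θ) ^ 2) = 0 →
      a = 0 ∧ b = 0 := by
    intro a b h1 h2
    have hb : b = 0 := by
      have h3 : b * (qStar θ / (qStar θ - θ.β * qStar θ)) =
          (a * (θ.β * qStar θ / qStar θ ^ 2) + b * (qStar θ * (qStar θ -
            2 * (θ.β * qStar θ)) / (qStar θ - θ.β * qStar θ) ^ 2)) +
          θ.β * (a * (-1 / qStar θ) +
            b * (qStar θ ^ 2 / (qStar θ - θ.β * qStar θ) ^ 2)) := by
        have hβ1 : 1 - θ.β ≠ 0 := (sub_pos.2 hθ.2.2.2.2.2).ne'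
        field_simp
        ring
      rw [h1, h2] at h3
      simpa [hd, hq] using h3
    rw [hb] at h2
    exact ⟨by simpa [hq] using h2, hb⟩
  have h0 := congrFun hv 0
  have h1 := congrFun hv 1
  have h2 := congrFun hv 2
  have h3 := congrFun hv 3
  simp only [Matrix.vecMul, dotProduct, Dg, Fin.sum_univ_four] at h0 h1 h2 h3
  simp only [Matrix.of_apply, Matrix.cons_val, Pi.zero_apply, mul_zero, add_zero, zero_add]
    at h0 h1 h2 h3
  obtain ⟨a0, a2⟩ := key _ _ h0 h1
  obtain ⟨a1, a3⟩ := key _ _ h2 h3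
  ext i
  fin_cases i
  exacts [a0, a1, a2, a3]

/-! ### Consistency of the plug-in precision matrices -/

/-- The matrix inverted in `ThetaBeta`, as a function of the moments and of the ratios
`n² / N_x`. -/
def covBeta (x : Fin 6 → ℝ) (r : Block → ℝ) : Matrix (Fin 3) (Fin 3) ℝ :=
  Dh (x 0) (x 1) (x 2) (x 3) (x 4) (x 5) *
    blockDiag (r .one • SigmaU (x 0) (x 1)) (r .two • SigmaU (x 2) (x 3))
      (r .between • SigmaU (x 4) (x 5)) *
    (Dh (x 0) (x 1) (x 2) (x 3) (x 4) (x 5)).transpose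

/-- The matrix inverted in `ThetaMu`, as a function of the moments and of the ratios
`n² / N_x`. -/
def covMu (x : Fin 6 → ℝ) (r : Block → ℝ) : Matrix (Fin 4) (Fin 4) ℝ :=
  Dg (x 0) (x 1) (x 2) (x 3) (x 4) (x 5) *
    blockDiag (r .one • SigmaU (x 0) (x 1)) (r .two • SigmaU (x 2) (x 3))
      (r .between • SigmaU (x 4) (x 5)) *
    (Dg (x 0) (x 1) (x 2) (x 3) (x 4) (x 5)).transpose

theorem ThetaBeta_eq {n : ℕ} (d : Data n) :
    ThetaBeta n d = (covBeta (momentVec d) fun k => (n : ℝ) ^ 2 / numPairs d.c k)⁻¹ := rfl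

theorem ThetaMu_eq {n : ℕ} (d : Data n) :
    ThetaMu n d = (covMu (momentVec d) fun k => (n : ℝ) ^ 2 / numPairs d.c k)⁻¹ := rfl

theorem SigmaBeta_eq (θ : Params) :
    SigmaBeta θ = covBeta (limitVec θ) fun k => (pairFrac θ k)⁻¹ := rfl

theorem SigmaMu_eq (θ : Params) :
    SigmaMu θ = covMu (limitVec θ) fun k => (pairFrac θ k)⁻¹ := rfl

theorem continuousAt_Dh {x : Fin 6 → ℝ} (h0 : x 0 ≠ 0) (h2 : x 2 ≠ 0) (h4 : x 4 ≠ 0) :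
    ContinuousAt (fun x : Fin 6 → ℝ => Dh (x 0) (x 1) (x 2) (x 3) (x 4) (x 5)) x := by
  refine continuousAt_pi.2 fun i => continuousAt_pi.2 fun j => ?_
  fin_cases i <;> fin_cases j <;> simp [Dh] <;>
    first
    | exact (continuous_apply _).continuousAt.inv₀ ‹_›
    | exact continuousAt_const.div (continuous_apply _).continuousAt ‹_›
    | fun_prop (disch := simp [*])

theorem continuousAt_Dg {x : Fin 6 → ℝ} (h0 : x 0 ≠ 0) (h2 : x 2 ≠ 0) (h4 : x 4 ≠ 0)
    (h01 : x 0 - x 1 ≠ 0) (h23 : x 2 - x 3 ≠ 0) (h45 : x 4 - x 5 ≠ 0) :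
    ContinuousAt (fun x : Fin 6 → ℝ => Dg (x 0) (x 1) (x 2) (x 3) (x 4) (x 5)) x := by
  refine continuousAt_pi.2 fun i => continuousAt_pi.2 fun j => ?_
  fin_cases i <;> fin_cases j <;> simp [Dg] <;>
    first
    | exact (continuous_apply _).continuousAt.inv₀ ‹_›
    | exact continuousAt_const.div (continuous_apply _).continuousAt ‹_›
    | fun_prop (disch := simp [*])

theorem continuous_blockDiag_SigmaU : Continuous fun p : (Fin 6 → ℝ) × (Block → ℝ) =>
    blockDiag (p.2 .one • SigmaU (p.1 0) (p.1 1)) (p.2 .two • SigmaU (p.1 2) (p.1 3))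
      (p.2 .between • SigmaU (p.1 4) (p.1 5)) := by
  refine continuous_pi fun i => continuous_pi fun j => ?_
  fin_cases i <;> fin_cases j <;> simp [blockDiag, SigmaU] <;> fun_prop

theorem continuousAt_mul_mul_transpose {X : Type*} [TopologicalSpace X] {m : ℕ}
    {D : X → Matrix (Fin m) (Fin 6) ℝ} {S : X → Matrix (Fin 6) (Fin 6) ℝ} {x : X}
    (hD : ContinuousAt D x) (hS : ContinuousAt S x) :
    ContinuousAt (fun x => D x * S x * (D x).transpose) x := by
  have hc : Continuous fun p : Matrix (Fin m) (Fin 6) ℝ × Matrix (Fin 6) (Fin 6) ℝ =>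
      p.1 * p.2 * p.1.transpose :=
    (continuous_fst.matrix_mul continuous_snd).matrix_mul continuous_fst.matrix_transpose
  exact ContinuousAt.comp (f := fun x => (D x, S x)) hc.continuousAt (hD.prodMk hS)

/-- Plug-in inverses of continuous functions of the moments and of the block sizes are
consistent. -/
theorem consistentAt_inv {θ : Params} (hθ : InModel θ) {m : ℕ}
    {F : (Fin 6 → ℝ) → (Block → ℝ) → Matrix (Fin m) (Fin m) ℝ}
    (hF : ContinuousAt (fun p : (Fin 6 → ℝ) × (Block → ℝ) => F p.1 p.2)
      (limitVec θ, fun k => (pairFrac θ k)⁻¹))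
    (hdet : (F (limitVec θ) fun k => (pairFrac θ k)⁻¹).det ≠ 0) {T : MatrixStat m}
    (hT : ∀ n d, T n d = (F (momentVec d) fun k => (n : ℝ) ^ 2 / numPairs d.c k)⁻¹) :
    ConsistentAt θ T (F (limitVec θ) fun k => (pairFrac θ k)⁻¹)⁻¹ := by
  rw [consistentAt_iff]
  have hinv : ContinuousAt (fun p : (Fin 6 → ℝ) × (Block → ℝ) => (F p.1 p.2)⁻¹)
      (limitVec θ, fun k => (pairFrac θ k)⁻¹) := by
    refine ContinuousAt.comp (g := fun A : Matrix (Fin m) (Fin m) ℝ => A⁻¹)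
      (continuousAt_matrix_inv _ ?_) hF
    rw [Ring.inverse_eq_inv']
    exact continuousAt_inv₀ hdet
  have h := ((convProb_momentVec hθ).prodMk (convProb_sq_div_numPairs hθ)).comp
    (F := Fin m → Fin m → ℝ) (f := fun p i j => (F p.1 p.2)⁻¹ i j) hinv
  refine h.congr (.of_forall fun n ω => ?_)
  funext i j
  rw [hT]

theorem limitVec_even_ne {θ : Params} (hθ : InModel θ) :
    limitVec θ 0 ≠ 0 ∧ limitVec θ 2 ≠ 0 ∧ limitVec θ 4 ≠ 0 :=
  have h := (qStar_pos hθ).ne'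
  ⟨h, h, h⟩

theorem limitVec_sub_ne {θ : Params} (hθ : InModel θ) :
    limitVec θ 0 - limitVec θ 1 ≠ 0 ∧ limitVec θ 2 - limitVec θ 3 ≠ 0 ∧
      limitVec θ 4 - limitVec θ 5 ≠ 0 := by
  have h : qStar θ - θ.β * qStar θ ≠ 0 := by
    have : qStar θ - θ.β * qStar θ = (1 - θ.β) * qStar θ := by ring
    rw [this]
    exact mul_ne_zero (sub_pos.2 hθ.2.2.2.2.2).ne' (qStar_pos hθ).ne'
  exact ⟨h, h, h⟩

theorem isUnit_det_of_posDef {m : ℕ} {M : Matrix (Fin m) (Fin m) ℝ} (h : M.PosDef) :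
    IsUnit M.det :=
  (Matrix.isUnit_iff_isUnit_det M).1 h.isUnit

theorem consistentAt_ThetaBeta {θ : Params} (hθ : InModel θ) (hβ : 0 < θ.β) :
    ConsistentAt θ ThetaBeta (SigmaBeta θ)⁻¹ := by
  obtain ⟨h0, h2, h4⟩ := limitVec_even_ne hθ
  rw [SigmaBeta_eq]
  refine consistentAt_inv hθ ?_ ?_ fun n d => ThetaBeta_eq d
  · exact continuousAt_mul_mul_transpose
      (ContinuousAt.comp (f := Prod.fst) (continuousAt_Dh h0 h2 h4) continuousAt_fst)
      continuous_blockDiag_SigmaU.continuousAt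
  · rw [← SigmaBeta_eq]
    exact (isUnit_det_of_posDef (SigmaBeta_posDef hθ hβ)).ne_zero

theorem consistentAt_ThetaMu {θ : Params} (hθ : InModel θ) (hβ : 0 < θ.β) :
    ConsistentAt θ ThetaMu (SigmaMu θ)⁻¹ := by
  obtain ⟨h0, h2, h4⟩ := limitVec_even_ne hθ
  obtain ⟨h01, h23, h45⟩ := limitVec_sub_ne hθ
  rw [SigmaMu_eq]
  refine consistentAt_inv hθ ?_ ?_ fun n d => ThetaMu_eq d
  · exact continuousAt_mul_mul_transpose
      (ContinuousAt.comp (f := Prod.fst) (continuousAt_Dg h0 h2 h4 h01 h23 h45) continuousAt_fst)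
      continuous_blockDiag_SigmaU.continuousAt
  · rw [← SigmaMu_eq]
    exact (isUnit_det_of_posDef (SigmaMu_posDef hθ hβ)).ne_zero

/-! ### Quadratic statistics with estimated weights -/

theorem quadForm_mulVec {m l : ℕ} (T : Matrix (Fin m) (Fin m) ℝ) (A : Matrix (Fin m) (Fin l) ℝ)
    (z : Fin l → ℝ) : quadForm T (A.mulVec z) = quadForm (A.transpose * T * A) z := by
  rw [quadForm, quadForm, ← Matrix.mulVec_mulVec, ← Matrix.mulVec_mulVec,
    Matrix.mulVec_transpose, dotProduct_comm z, ← Matrix.dotProduct_mulVec, dotProduct_comm]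

theorem quadForm_sub {m : ℕ} (K L : Matrix (Fin m) (Fin m) ℝ) (z : Fin m → ℝ) :
    quadForm K z - quadForm L z = ∑ i, ∑ j, (K i j - L i j) * z j * z i := by
  simp only [quadForm, dotProduct, Matrix.mulVec, Finset.mul_sum]
  rw [← Finset.sum_sub_distrib]
  refine Finset.sum_congr rfl fun i _ => ?_
  rw [← Finset.sum_sub_distrib]
  exact Finset.sum_congr rfl fun j _ => by ring

/-- The quadratic form of `M(û) Z` with a consistent weight matrix is asymptotically chi-squared:
replacing `M(û)` and the weights by their limits changes it by `Zᵀ K Z`, where `K → 0` and `Z` is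
bounded in probability. -/
theorem limsup_law_quadForm_gt_le {θ : Params} (hθ : InModel θ) {m : ℕ}
    {M : (Fin 6 → ℝ) → Matrix (Fin m) (Fin 6) ℝ} (hM : ContinuousAt M (limitVec θ))
    (hpos : (M (limitVec θ) * momentCov θ * (M (limitVec θ)).transpose).PosDef)
    {T : MatrixStat m}
    (hT : ConsistentAt θ T (M (limitVec θ) * momentCov θ * (M (limitVec θ)).transpose)⁻¹)
    (x : ℝ) :
    limsup (fun n => law θ n {ω | x < quadForm (T n (observe ω))
      ((M (momentVec (observe ω))).mulVec (fluct θ n ω))}) atTop ≤ chiSquared m (Set.Ici x) := by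
  set D := M (limitVec θ) with hD
  set P := (D * momentCov θ * D.transpose)⁻¹ with hP
  set R : ∀ n, Sample n → ℝ := fun n ω => quadForm (T n (observe ω))
    ((M (momentVec (observe ω))).mulVec (fluct θ n ω)) - quadForm P (D.mulVec (fluct θ n ω)) with hR
  have hRconv : ConvProb (law θ) R 0 := by
    have hTx := (consistentAt_iff.1 hT).prodMk (convProb_momentVec hθ)
    have hK : ∀ i j, ConvProb (law θ) (fun n (ω : Sample n) =>
        ((M (momentVec (observe ω))).transpose * T n (observe ω) * M (momentVec (observe ω))) i j -
          (D.transpose * P * D) i j) 0 := by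
      intro i j
      have hc : Continuous fun p : Matrix (Fin m) (Fin m) ℝ × Matrix (Fin m) (Fin 6) ℝ =>
          (p.2.transpose * p.1 * p.2) i j - (D.transpose * P * D) i j := by
        refine Continuous.sub ?_ continuous_const
        exact Continuous.matrix_elem (by fun_prop) i j
      have hf : ContinuousAt (fun p : (Fin m → Fin m → ℝ) × (Fin 6 → ℝ) =>
          ((M p.2).transpose * Matrix.of p.1 * M p.2) i j - (D.transpose * P * D) i j)
          ((fun i j => P i j), limitVec θ) := by
        refine hc.continuousAt.comp (f := fun p : (Fin m → Fin m → ℝ) × (Fin 6 → ℝ) =>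
          (Matrix.of p.1, M p.2)) (ContinuousAt.prodMk ?_ ?_)
        · exact continuousAt_fst
        · exact ContinuousAt.comp (f := Prod.snd) hM continuousAt_snd
      have h := hTx.comp hf
      have h0 : ((M (limitVec θ)).transpose * Matrix.of (fun i j => P i j) * M (limitVec θ)) i j -
          (D.transpose * P * D) i j = 0 := sub_self _
      simp only at h
      rw [h0] at h
      exact h
    have hsum := convProb_sum (μ := law θ) Finset.univ fun i _ =>
      convProb_sum Finset.univ fun j _ =>
        ((hK i j).mul_tightSeq (tightSeq_fluct hθ j)).mul_tightSeq (tightSeq_fluct hθ i)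
    refine hsum.congr (.of_forall fun n ω => ?_)
    rw [hR]
    simp only
    rw [quadForm_mulVec, quadForm_mulVec, quadForm_sub]
  refine ge_of_tendsto' (tendsto_measure_Ici_sub (chiSquared m) x) fun k => ?_
  have hk : (0 : ℝ) < 1 / ((k : ℝ) + 1) := by positivity
  refine limsup_le_of_le_add (.of_forall fun n => ?_)
    (limsup_law_quadForm_le hθ hpos (x - 1 / ((k : ℝ) + 1))) (hRconv _ hk)
  refine le_trans (measure_mono fun ω hω => ?_) (measure_union_le _ _)
  by_contra hcon
  simp only [Set.mem_union, Set.mem_ofPred_eq, not_or, not_le, Real.dist_eq, sub_zero] at hcon hω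
  have h1 := (abs_lt.1 hcon.2).2
  have h2 := hcon.1
  simp only [hR] at h1
  linarith

/-! ### Exact linearisation of the estimators under balanced errors -/

/-- The matrix taking `fluct` to `(n (β̂_b - β), √n γ̂₁, √n γ̂₂)` when the error rates of all blocks
equal `β`; it depends on the moments `x`, so that the identity is exact. -/
def linBeta (β : ℝ) (x : Fin 6 → ℝ) : Matrix (Fin 3) (Fin 6) ℝ :=
  !![0, 0, 0, 0, -β / x 4, 1 / x 4;
     β / x 0, -1 / x 0, 0, 0, -β / x 4, 1 / x 4;
     0, 0, β / x 2, -1 / x 2, -β / x 4, 1 / x 4]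

/-- The matrix taking `fluct` to `√n (γ̂₁, γ̂₂, μ̂₁, μ̂₂)` when error rates and edge probabilities
of all blocks equal `β` and `q`; `s` stands for the mean `(1 - β) q` of the first moments. -/
def linMu (β q s : ℝ) (x : Fin 6 → ℝ) : Matrix (Fin 4) (Fin 6) ℝ :=
  !![β / x 0, -1 / x 0, 0, 0, -β / x 4, 1 / x 4;
     0, 0, β / x 2, -1 / x 2, -β / x 4, 1 / x 4;
     (x 0 + s - q) / (x 0 - x 1), q / (x 0 - x 1), 0, 0,
       -(x 4 + s - q) / (x 4 - x 5), -q / (x 4 - x 5);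
     0, 0, (x 2 + s - q) / (x 2 - x 3), q / (x 2 - x 3),
       -(x 4 + s - q) / (x 4 - x 5), -q / (x 4 - x 5)]

theorem continuousAt_linBeta (β : ℝ) {x : Fin 6 → ℝ} (h0 : x 0 ≠ 0) (h2 : x 2 ≠ 0)
    (h4 : x 4 ≠ 0) : ContinuousAt (linBeta β) x := by
  refine continuousAt_pi.2 fun i => continuousAt_pi.2 fun j => ?_
  fin_cases i <;> fin_cases j <;> simp [linBeta] <;>
    first
    | exact (continuous_apply _).continuousAt.inv₀ ‹_›
    | exact continuousAt_const.div (continuous_apply _).continuousAt ‹_›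
    | fun_prop (disch := simp [*])

theorem continuousAt_linMu (β q s : ℝ) {x : Fin 6 → ℝ} (h0 : x 0 ≠ 0) (h2 : x 2 ≠ 0)
    (h4 : x 4 ≠ 0) (h01 : x 0 - x 1 ≠ 0) (h23 : x 2 - x 3 ≠ 0) (h45 : x 4 - x 5 ≠ 0) :
    ContinuousAt (linMu β q s) x := by
  refine continuousAt_pi.2 fun i => continuousAt_pi.2 fun j => ?_
  fin_cases i <;> fin_cases j <;> simp [linMu] <;>
    first
    | exact (continuous_apply _).continuousAt.inv₀ ‹_›
    | exact continuousAt_const.div (continuous_apply _).continuousAt ‹_›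
    | fun_prop (disch := simp [*])

theorem linBeta_limitVec {θ : Params} (hθ : InModel θ) :
    linBeta θ.β (limitVec θ) =
      Dh (qStar θ) (θ.β * qStar θ) (qStar θ) (θ.β * qStar θ) (qStar θ) (θ.β * qStar θ) := by
  have hq := (qStar_pos hθ).ne'
  have h : θ.β * qStar θ / qStar θ ^ 2 = θ.β / qStar θ := by field_simp
  ext i j
  fin_cases i <;> fin_cases j <;> simp [linBeta, Dh, limitVec, h, neg_div]

theorem linMu_limitVec {θ : Params} (hθ : InModel θ) :
    linMu θ.β θ.q (qStar θ) (limitVec θ) =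
      Dg (qStar θ) (θ.β * qStar θ) (qStar θ) (θ.β * qStar θ) (qStar θ) (θ.β * qStar θ) := by
  have hq := hθ.2.2.1.ne'
  have hβ := (sub_pos.2 hθ.2.2.2.2.2).ne'
  have hs : qStar θ ≠ 0 := (qStar_pos hθ).ne'
  have h : θ.β * qStar θ / qStar θ ^ 2 = θ.β / qStar θ := by field_simp
  have hd : qStar θ - θ.β * qStar θ = (1 - θ.β) ^ 2 * θ.q := by rw [qStar]; ring
  have h1 : (qStar θ + qStar θ - θ.q) / (qStar θ - θ.β * qStar θ) =
      qStar θ * (qStar θ - 2 * (θ.β * qStar θ)) / (qStar θ - θ.β * qStar θ) ^ 2 := by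
    rw [hd, qStar]
    field_simp
    ring
  have h2 : θ.q / (qStar θ - θ.β * qStar θ) =
      qStar θ ^ 2 / (qStar θ - θ.β * qStar θ) ^ 2 := by
    rw [hd, qStar]
    field_simp
  ext i j
  fin_cases i <;> fin_cases j <;>
    simp only [linMu, Dg, limitVec, neg_div, Matrix.of_apply, Matrix.cons_val, Fin.zero_eta,
      Fin.mk_one, Fin.reduceFinMk, Fin.isValue, h, h1, h2]

theorem errProb_eq {θ : Params} (h₁ : θ.γ₁ = 0) (h₂ : θ.γ₂ = 0) (n : ℕ) (k : Block) :
    errProb θ n k = θ.β := by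
  cases k <;> simp [errProb, h₁, h₂]

theorem edgeProb_eq {θ : Params} (h₁ : θ.μ₁ = 0) (h₂ : θ.μ₂ = 0) (n : ℕ) (k : Block) :
    edgeProb θ n k = θ.q := by
  cases k <;> simp [edgeProb, h₁, h₂]

theorem mean₂_eq {θ : Params} (hθ : InModel θ) (h₁ : θ.γ₁ = 0) (h₂ : θ.γ₂ = 0) (n : ℕ)
    (k : Block) : mean₂ θ n k = θ.β * mean₁ θ n k := by
  rw [mean₂, errProb_eq h₁ h₂, coe_toUnit hθ.2.2.2.2.1 hθ.2.2.2.2.2.le]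

theorem mean₁_eq {θ : Params} (hθ : InModel θ) (h₁ : θ.γ₁ = 0) (h₂ : θ.γ₂ = 0) (h₃ : θ.μ₁ = 0)
    (h₄ : θ.μ₂ = 0) (n : ℕ) (k : Block) : mean₁ θ n k = qStar θ := by
  rw [mean₁, errProb_eq h₁ h₂, edgeProb_eq h₃ h₄, coe_toUnit hθ.2.2.2.2.1 hθ.2.2.2.2.2.le,
    coe_toUnit hθ.2.2.1.le hθ.2.2.2.1.le, qStar]

theorem betaHat_sub_eq {n : ℕ} {d : Data n} {k : Block} (hu : u₁ d k ≠ 0) {β m₁ m₂ : ℝ}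
    (hm : m₂ = β * m₁) : n * (betaHat d k - β) =
      -β / u₁ d k * (n * (u₁ d k - m₁)) + 1 / u₁ d k * (n * (u₂ d k - m₂)) := by
  rw [betaHat, hm]
  field_simp
  ring

theorem edgeHat_sub_eq {n : ℕ} {d : Data n} {k : Block} (hu : u₁ d k ≠ 0)
    (huv : u₁ d k - u₂ d k ≠ 0) {β q s : ℝ} (hs : s = (1 - β) * q) :
    n * (u₁ d k / (1 - betaHat d k) - q) =
      (u₁ d k + s - q) / (u₁ d k - u₂ d k) * (n * (u₁ d k - s)) +
        q / (u₁ d k - u₂ d k) * (n * (u₂ d k - β * s)) := by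
  have h1 : 1 - betaHat d k = (u₁ d k - u₂ d k) / u₁ d k := by
    rw [betaHat]; field_simp
  rw [h1, hs]
  field_simp
  ring

theorem sqrt_mul_gammaHat {n : ℕ} (d : Data n) (g : Block) (β : ℝ) :
    √n * gammaHat d g = n * (betaHat d .between - β) - n * (betaHat d g - β) := by
  rw [gammaHat, ← mul_assoc, Real.mul_self_sqrt (Nat.cast_nonneg n)]
  ring

theorem sqrt_mul_muHat {n : ℕ} (d : Data n) (g : Block) (q : ℝ) :
    √n * muHat d g = n * (u₁ d g / (1 - betaHat d g) - q) -
      n * (u₁ d .between / (1 - betaHat d .between) - q) := by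
  rw [muHat, ← mul_assoc, Real.mul_self_sqrt (Nat.cast_nonneg n)]
  ring

theorem linBeta_mulVec_fluct {θ : Params} (hθ : InModel θ) (h₁ : θ.γ₁ = 0) (h₂ : θ.γ₂ = 0) {n : ℕ}
    {ω : Sample n} (h0 : momentVec (observe ω) 0 ≠ 0) (h2 : momentVec (observe ω) 2 ≠ 0)
    (h4 : momentVec (observe ω) 4 ≠ 0) :
    ![n * (betaHat (observe ω) .between - θ.β), √n * gammaHat (observe ω) .one,
      √n * gammaHat (observe ω) .two] =
      (linBeta θ.β (momentVec (observe ω))).mulVec (fluct θ n ω) := by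
  rw [sqrt_mul_gammaHat _ _ θ.β, sqrt_mul_gammaHat _ _ θ.β,
    betaHat_sub_eq h0 (mean₂_eq hθ h₁ h₂ n .one), betaHat_sub_eq h2 (mean₂_eq hθ h₁ h₂ n .two),
    betaHat_sub_eq h4 (mean₂_eq hθ h₁ h₂ n .between)]
  ext i
  fin_cases i <;>
    simp [linBeta, Matrix.mulVec, dotProduct, Fin.sum_univ_six, fluct, momentVec, meanVec] <;> ring

theorem linMu_mulVec_fluct {θ : Params} (hθ : InModel θ) (h₁ : θ.γ₁ = 0) (h₂ : θ.γ₂ = 0)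
    (h₃ : θ.μ₁ = 0) (h₄ : θ.μ₂ = 0) {n : ℕ} {ω : Sample n}
    (h0 : momentVec (observe ω) 0 ≠ 0) (h2 : momentVec (observe ω) 2 ≠ 0)
    (h4 : momentVec (observe ω) 4 ≠ 0)
    (h01 : momentVec (observe ω) 0 - momentVec (observe ω) 1 ≠ 0)
    (h23 : momentVec (observe ω) 2 - momentVec (observe ω) 3 ≠ 0)
    (h45 : momentVec (observe ω) 4 - momentVec (observe ω) 5 ≠ 0) :
    (√n • ![gammaHat (observe ω) .one, gammaHat (observe ω) .two, muHat (observe ω) .one,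
      muHat (observe ω) .two] : Fin 4 → ℝ) =
      (linMu θ.β θ.q (qStar θ) (momentVec (observe ω))).mulVec (fluct θ n ω) := by
  have hm₂ : ∀ k, mean₂ θ n k = θ.β * qStar θ := fun k => by
    rw [mean₂_eq hθ h₁ h₂, mean₁_eq hθ h₁ h₂ h₃ h₄]
  have hm₁ := mean₁_eq hθ h₁ h₂ h₃ h₄ n
  ext i
  fin_cases i
  · change √n * gammaHat (observe ω) .one = _
    rw [sqrt_mul_gammaHat _ _ θ.β, betaHat_sub_eq h0 (mean₂_eq hθ h₁ h₂ n .one),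
      betaHat_sub_eq h4 (mean₂_eq hθ h₁ h₂ n .between)]
    simp [linMu, Matrix.mulVec, dotProduct, Fin.sum_univ_six, fluct, momentVec, meanVec]
    ring
  · change √n * gammaHat (observe ω) .two = _
    rw [sqrt_mul_gammaHat _ _ θ.β, betaHat_sub_eq h2 (mean₂_eq hθ h₁ h₂ n .two),
      betaHat_sub_eq h4 (mean₂_eq hθ h₁ h₂ n .between)]
    simp [linMu, Matrix.mulVec, dotProduct, Fin.sum_univ_six, fluct, momentVec, meanVec]
    ring
  · change √n * muHat (observe ω) .one = _
    rw [sqrt_mul_muHat _ _ θ.q, edgeHat_sub_eq h0 h01 (rfl : qStar θ = _),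
      edgeHat_sub_eq h4 h45 (rfl : qStar θ = _)]
    simp [linMu, Matrix.mulVec, dotProduct, Fin.sum_univ_six, fluct, momentVec, meanVec, hm₁, hm₂]
    ring
  · change √n * muHat (observe ω) .two = _
    rw [sqrt_mul_muHat _ _ θ.q, edgeHat_sub_eq h2 h23 (rfl : qStar θ = _),
      edgeHat_sub_eq h4 h45 (rfl : qStar θ = _)]
    simp [linMu, Matrix.mulVec, dotProduct, Fin.sum_univ_six, fluct, momentVec, meanVec, hm₁, hm₂]
    ring

theorem quadForm_smul {m : ℕ} (T : Matrix (Fin m) (Fin m) ℝ) (a : ℝ) (v : Fin m → ℝ) :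
    quadForm T (a • v) = a ^ 2 * quadForm T v := by
  simp only [quadForm, Matrix.mulVec_smul, dotProduct_smul, smul_dotProduct, smul_eq_mul]
  ring

/-! ### Level of the test -/

theorem limsup_law_QBeta_le {θ : Params} (hθ : InModel θ) (hβ : 0 < θ.β) (h₁ : θ.γ₁ = 0)
    (h₂ : θ.γ₂ = 0) {T : MatrixStat 3} (hT : ConsistentAt θ T (SigmaBeta θ)⁻¹) (x : ℝ) :
    limsup (fun n => law θ n {ω | x < QBeta T (observe ω) θ.β}) atTop ≤
      chiSquared 3 (Set.Ici x) := by
  obtain ⟨h0, h2, h4⟩ := limitVec_even_ne hθ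
  have hS : linBeta θ.β (limitVec θ) * momentCov θ * (linBeta θ.β (limitVec θ)).transpose =
      SigmaBeta θ := by
    rw [linBeta_limitVec hθ]; rfl
  have hU : {x : Fin 6 → ℝ | x 0 ≠ 0 ∧ x 2 ≠ 0 ∧ x 4 ≠ 0} ∈ 𝓝 (limitVec θ) :=
    (((continuous_apply 0).continuousAt.eventually_ne h0).and
      (((continuous_apply 2).continuousAt.eventually_ne h2).and
        ((continuous_apply 4).continuousAt.eventually_ne h4)))
  refine limsup_le_of_le_add (.of_forall fun n => ?_)
    (limsup_law_quadForm_gt_le hθ (continuousAt_linBeta θ.β h0 h2 h4)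
      (by rw [hS]; exact SigmaBeta_posDef hθ hβ) (T := T) (by rw [hS]; exact hT) x)
    ((convProb_momentVec hθ).measure_notMem hU)
  refine le_trans (measure_mono fun ω hω => ?_) (measure_union_le _ _)
  by_cases hx : momentVec (observe ω) ∈ {x : Fin 6 → ℝ | x 0 ≠ 0 ∧ x 2 ≠ 0 ∧ x 4 ≠ 0}
  · left
    rw [Set.mem_ofPred_eq, QBeta, linBeta_mulVec_fluct hθ h₁ h₂ hx.1 hx.2.1 hx.2.2] at hω
    exact hω
  · exact Or.inr hx

theorem limsup_law_QMu_le {θ : Params} (hθ : InModel θ) (hβ : 0 < θ.β) (h₁ : θ.γ₁ = 0)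
    (h₂ : θ.γ₂ = 0) (h₃ : θ.μ₁ = 0) (h₄ : θ.μ₂ = 0) {T : MatrixStat 4}
    (hT : ConsistentAt θ T (SigmaMu θ)⁻¹) (x : ℝ) :
    limsup (fun n => law θ n {ω | x < QMu T (observe ω)}) atTop ≤ chiSquared 4 (Set.Ici x) := by
  obtain ⟨h0, h2, h4⟩ := limitVec_even_ne hθ
  obtain ⟨h01, h23, h45⟩ := limitVec_sub_ne hθ
  have hS : linMu θ.β θ.q (qStar θ) (limitVec θ) * momentCov θ *
      (linMu θ.β θ.q (qStar θ) (limitVec θ)).transpose = SigmaMu θ := by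
    rw [linMu_limitVec hθ]; rfl
  set U : Set (Fin 6 → ℝ) := {x | (x 0 ≠ 0 ∧ x 2 ≠ 0 ∧ x 4 ≠ 0) ∧
    x 0 - x 1 ≠ 0 ∧ x 2 - x 3 ≠ 0 ∧ x 4 - x 5 ≠ 0} with hUdef
  have hU : U ∈ 𝓝 (limitVec θ) := by
    have hsub : ∀ i j : Fin 6, ContinuousAt (fun x : Fin 6 → ℝ => x i - x j) (limitVec θ) :=
      fun i j => by fun_prop
    exact (((continuous_apply 0).continuousAt.eventually_ne h0).and
      (((continuous_apply 2).continuousAt.eventually_ne h2).and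
        ((continuous_apply 4).continuousAt.eventually_ne h4))).and
      (((hsub 0 1).eventually_ne h01).and
        (((hsub 2 3).eventually_ne h23).and ((hsub 4 5).eventually_ne h45)))
  refine limsup_le_of_le_add (.of_forall fun n => ?_)
    (limsup_law_quadForm_gt_le hθ (continuousAt_linMu θ.β θ.q (qStar θ) h0 h2 h4 h01 h23 h45)
      (by rw [hS]; exact SigmaMu_posDef hθ hβ) (T := T) (by rw [hS]; exact hT) x)
    ((convProb_momentVec hθ).measure_notMem hU)
  refine le_trans (measure_mono fun ω hω => ?_) (measure_union_le _ _)
  by_cases hx : momentVec (observe ω) ∈ U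
  · left
    obtain ⟨⟨a, b, c⟩, d, e, f⟩ := hx
    rw [Set.mem_ofPred_eq, QMu, ← Real.sq_sqrt (Nat.cast_nonneg n), ← quadForm_smul,
      linMu_mulVec_fluct hθ h₁ h₂ h₃ h₄ a b c d e f] at hω
    exact hω
  · exact Or.inr hx

theorem continuous_QBeta (T : MatrixStat 3) {n : ℕ} (d : Data n) : Continuous (QBeta T d) := by
  unfold QBeta quadForm
  have hv : Continuous fun b : ℝ => ![n * (betaHat d .between - b), √n * gammaHat d .one,
      √n * gammaHat d .two] := by
    refine continuous_pi fun i => ?_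
    fin_cases i <;> simp <;> fun_prop
  exact hv.dotProduct (continuous_const.matrix_mulVec hv)

theorem testFn_eq_one {Tβ : MatrixStat 3} {Tμ : MatrixStat 4} {βbar α : ℝ} {n : ℕ} {d : Data n}
    (h : testFn Tβ Tμ βbar α d = 1) :
    d.Y ≠ d.Ystar ∧ chiQuantile 3 α < sInf (QBeta Tβ d '' Set.Icc 0 βbar) ∧
      chiQuantile 4 α < QMu Tμ d := by
  unfold testFn at h
  refine ⟨?_, ?_, ?_⟩ <;> by_contra hcon <;> simp [hcon] at h

theorem law_ne_eq_zero {θ : Params} (hβ : θ.β = 0) (h₁ : θ.γ₁ = 0) (h₂ : θ.γ₂ = 0) (n : ℕ) :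
    law θ n {ω | (observe ω).Y ≠ (observe ω).Ystar} = 0 := by
  have hedge : ∀ p : ℝ, edgeLaw p 0 {w | w.2.1 ≠ w.2.2} = 0 := by
    intro p
    have h0 : (toUnit 0 : ℝ) = 0 := coe_toUnit le_rfl zero_le_one
    have h := integral_edgeLaw p 0 (Set.indicator {w | w.2.1 ≠ w.2.2} 1)
    rw [integral_indicator_one .of_discrete] at h
    simp [h0, Set.indicator] at h
    exact (measureReal_eq_zero_iff).1 h
  rw [law_apply]
  refine lintegral_eq_zero_of_ae_eq_zero (.of_forall fun c => ?_)
  have hsub : Prod.mk c ⁻¹' {ω : Sample n | (observe ω).Y ≠ (observe ω).Ystar} ⊆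
      ⋃ e : Pair n, (Function.eval e) ⁻¹' {w : Bool × Bool × Bool | w.2.1 ≠ w.2.2} := by
    intro w hw
    by_contra hcon
    simp only [Set.mem_iUnion, Set.mem_preimage, Set.mem_ofPred_eq, not_exists, not_not] at hcon
    exact hw (funext hcon)
  refine measure_mono_null hsub (measure_iUnion_null fun e => ?_)
  rw [pairLaw, (measurePreserving_eval (fun e : Pair n =>
    edgeLaw (edgeProb θ n (block c e)) (errProb θ n (block c e))) e).measure_preimage
      MeasurableSet.of_discrete.nullMeasurableSet, errProb_eq h₁ h₂, hβ]
  exact hedge _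

/-- For `β = 0` there are no errors and the test never rejects. For `β > 0`, one of the two
statistics is asymptotically chi-squared at every null parameter. -/
theorem limsup_rejectProb_le {βbar α : ℝ} (hα : 0 < α ∧ α < 1) (Tβ : MatrixStat 3)
    (Tμ : MatrixStat 4) {θ : Params} (hθ : InModel θ) (hnull : InNull βbar θ)
    (hT : 0 < θ.β → ConsistentAt θ Tβ (SigmaBeta θ)⁻¹ ∧ ConsistentAt θ Tμ (SigmaMu θ)⁻¹) :
    limsup (fun n : ℕ => rejectProb Tβ Tμ βbar α θ n) atTop ≤ ENNReal.ofReal α := by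
  have hγ : θ.γ₁ = 0 ∧ θ.γ₂ = 0 := by
    rcases hnull with h | h <;> exact ⟨h.1, h.2.1⟩
  rcases hθ.2.2.2.2.1.eq_or_lt with hβ | hβ
  · have h0 : ∀ n, rejectProb Tβ Tμ βbar α θ n = 0 := fun n =>
      measure_mono_null (fun ω hω => (testFn_eq_one hω).1)
        (law_ne_eq_zero hβ.symm hγ.1 hγ.2 n)
    simp [h0]
  obtain ⟨hTβ, hTμ⟩ := hT hβ
  rcases hnull with ⟨-, -, -, hle⟩ | ⟨-, -, h₃, h₄⟩
  · refine le_trans ?_ ((limsup_law_QBeta_le hθ hβ hγ.1 hγ.2 hTβ (chiQuantile 3 α)).trans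
      (chiSquared_Ici_chiQuantile_le 2 hα.1 hα.2))
    refine limsup_le_limsup (.of_forall fun n => measure_mono fun ω hω => ?_)
    have hbdd : BddBelow (QBeta Tβ (observe ω) '' Set.Icc 0 βbar) :=
      isCompact_Icc.bddBelow_image (continuous_QBeta Tβ (observe ω)).continuousOn
    exact (testFn_eq_one hω).2.1.trans_le (csInf_le hbdd ⟨θ.β, ⟨hβ.le, hle⟩, rfl⟩)
  · refine le_trans ?_ ((limsup_law_QMu_le hθ hβ hγ.1 hγ.2 h₃ h₄ hTμ (chiQuantile 4 α)).trans
      (chiSquared_Ici_chiQuantile_le 3 hα.1 hα.2))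
    exact limsup_le_limsup (.of_forall fun n => measure_mono fun ω hω => (testFn_eq_one hω).2.2)

end

end NoisySBM

theorem theorem3 (βbar : ℝ) (hβbar : 0 < βbar ∧ βbar < 1) (α : ℝ) (hα : 0 < α ∧ α < 1) :
    -- the test with the plug-in weight matrices has asymptotic level `α` on the null hypothesis
    (∀ θ : NoisySBM.Params, NoisySBM.InModel θ → NoisySBM.InNull βbar θ →
      Filter.limsup
        (fun n : ℕ => NoisySBM.rejectProb NoisySBM.ThetaBeta NoisySBM.ThetaMu βbar α θ n)
        Filter.atTop ≤ ENNReal.ofReal α) ∧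
    -- the plug-in matrices are consistent estimators of the asymptotic precision matrices
    (∀ θ : NoisySBM.Params, NoisySBM.InModel θ → 0 < θ.β →
      IsUnit (NoisySBM.SigmaBeta θ).det ∧ IsUnit (NoisySBM.SigmaMu θ).det ∧
      NoisySBM.ConsistentAt θ NoisySBM.ThetaBeta (NoisySBM.SigmaBeta θ)⁻¹ ∧
      NoisySBM.ConsistentAt θ NoisySBM.ThetaMu (NoisySBM.SigmaMu θ)⁻¹) ∧
    -- the same level holds with any other consistent estimators in their place
    (∀ (Tβ : NoisySBM.MatrixStat 3) (Tμ : NoisySBM.MatrixStat 4) (θ : NoisySBM.Params),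
      NoisySBM.InModel θ → NoisySBM.InNull βbar θ →
      (0 < θ.β → NoisySBM.ConsistentAt θ Tβ (NoisySBM.SigmaBeta θ)⁻¹ ∧
        NoisySBM.ConsistentAt θ Tμ (NoisySBM.SigmaMu θ)⁻¹) →
      Filter.limsup (fun n : ℕ => NoisySBM.rejectProb Tβ Tμ βbar α θ n)
        Filter.atTop ≤ ENNReal.ofReal α) :=
  ⟨fun _ hθ hnull => NoisySBM.limsup_rejectProb_le hα _ _ hθ hnull fun hβ =>
      ⟨NoisySBM.consistentAt_ThetaBeta hθ hβ, NoisySBM.consistentAt_ThetaMu hθ hβ⟩,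
    fun _ hθ hβ =>
      ⟨NoisySBM.isUnit_det_of_posDef (NoisySBM.SigmaBeta_posDef hθ hβ),
        NoisySBM.isUnit_det_of_posDef (NoisySBM.SigmaMu_posDef hθ hβ),
        NoisySBM.consistentAt_ThetaBeta hθ hβ, NoisySBM.consistentAt_ThetaMu hθ hβ⟩,
    fun Tβ Tμ _ hθ hnull hT => NoisySBM.limsup_rejectProb_le hα Tβ Tμ hθ hnull hT⟩
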